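/- Let $(M,\omega)$ be a smooth symplectic manifold of dimension $2n$ (Hausdorff, second countable, without boundary; $\omega$ a smooth closed nondegenerate 2-form), and let $L\subset M$ be a compact Lagrangian submanifold, i.e. a compact embedded $n$-dimensional submanifold without boundary with $\omega|_{TL}=0$. Let $B^{2n}(r)\subset\mathbb C^n$ denote the closed ball of radius $r$ centered at the origin, with the standard symplectic form $\omega_0=\sum_j dx_j\wedge dy_j$, $z_j=x_j+iy_j$, and let $\mathbb R^n=\{y=0\}\subset\mathbb C^n$. Then there exists $r>0$, depending only on $(M,\omega)$ and $L$, such that for every $p\in L$ there is a smooth symplectic embedding $e:(B^{2n}(r),\omega_0)\to(M,\omega)$ with $e(0)=p$ and $$e^{-1}(L)=B^{2n}(r)\cap\mathbb R^n .$$ -/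

import Mathlib

open Set Metric Topology
open scoped Manifold ContDiff

noncomputable section

/-- A (not necessarily smooth) differential 2-form on a manifold `M` modelled on `ℝ^d`. -/
abbrev TwoForm (d : ℕ) (M : Type*) [TopologicalSpace M]
    [ChartedSpace (EuclideanSpace ℝ (Fin d)) M] : Type _ :=
  ∀ x : M, TangentSpace (𝓡 d) x [⋀^Fin 2]→L[ℝ] ℝ

/-- The local representative of a 2-form in the preferred chart at `x₀`, i.e. the pullback of `Ω`
by the inverse of this chart. It is meaningful on the (open) target of the chart. -/
def TwoForm.localRep {d : ℕ} {M : Type*} [TopologicalSpace M]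
    [ChartedSpace (EuclideanSpace ℝ (Fin d)) M] (Ω : TwoForm d M) (x₀ : M)
    (y : EuclideanSpace ℝ (Fin d)) : EuclideanSpace ℝ (Fin d) [⋀^Fin 2]→L[ℝ] ℝ :=
  (Ω ((extChartAt (𝓡 d) x₀).symm y)).compContinuousLinearMap
    (mfderiv (𝓡 d) (𝓡 d) (extChartAt (𝓡 d) x₀).symm y)

/-- A symplectic form: a smooth, closed, nondegenerate 2-form. Smoothness and closedness are
expressed in the charts `chartAt x₀`, which cover the manifold. -/
structure IsSymplecticForm {d : ℕ} {M : Type*} [TopologicalSpace M]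
    [ChartedSpace (EuclideanSpace ℝ (Fin d)) M] (Ω : TwoForm d M) : Prop where
  smooth : ∀ x₀ : M, ContDiffOn ℝ ∞ (Ω.localRep x₀) (extChartAt (𝓡 d) x₀).target
  closed : ∀ x₀ : M, ∀ y ∈ (extChartAt (𝓡 d) x₀).target, extDeriv (Ω.localRep x₀) y = 0
  nondegenerate : ∀ (x : M) (v : TangentSpace (𝓡 d) x),
    (∀ w : TangentSpace (𝓡 d) x, Ω x ![v, w] = 0) → v = 0

/-- `L ⊆ M` is a Lagrangian submanifold of the `2n`-dimensional manifold `M` with 2-form `Ω`: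
an embedded smooth submanifold (without boundary) of dimension `n` on which `Ω` vanishes.
Here `L` carries the subspace topology. -/
def IsLagrangianSubmanifold {n : ℕ} {M : Type*} [TopologicalSpace M]
    [ChartedSpace (EuclideanSpace ℝ (Fin (2 * n))) M] (Ω : TwoForm (2 * n) M) (L : Set M) :
    Prop :=
  ∃ _ : ChartedSpace (EuclideanSpace ℝ (Fin n)) L,
    IsManifold (𝓡 n) ∞ L ∧
    Manifold.IsSmoothEmbedding (𝓡 n) (𝓡 (2 * n)) ∞ (Subtype.val : L → M) ∧
    ∀ (x : L) (u v : TangentSpace (𝓡 n) x),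
      Ω (x : M) ![mfderiv (𝓡 n) (𝓡 (2 * n)) (Subtype.val : L → M) x u,
        mfderiv (𝓡 n) (𝓡 (2 * n)) (Subtype.val : L → M) x v] = 0

/-- The standard symplectic form `∑ⱼ dxⱼ ∧ dyⱼ` on `ℂⁿ`, where `zⱼ = xⱼ + i yⱼ`. -/
def stdSymplecticForm {n : ℕ} (u v : EuclideanSpace ℂ (Fin n)) : ℝ :=
  ∑ j, ((u j).re * (v j).im - (u j).im * (v j).re)

/-- The subspace `ℝⁿ ⊆ ℂⁿ`. -/
def realPoints (n : ℕ) : Set (EuclideanSpace ℂ (Fin n)) := {z | ∀ j, (z j).im = 0}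

/-- `e` restricts to a symplectic embedding into `(M, Ω)` of the closed ball of radius `r` centred
at the origin of `ℂⁿ`. Only the restriction of `e` to the ball matters; as usual for maps on
closed sets, smoothness means smoothness of an extension to an open neighbourhood. (Injectivity of
the derivative follows from the nondegeneracy of the standard form.) -/
structure IsSymplecticBallEmbedding {n : ℕ} {M : Type*} [TopologicalSpace M]
    [ChartedSpace (EuclideanSpace ℝ (Fin (2 * n))) M] (Ω : TwoForm (2 * n) M) (r : ℝ)
    (e : EuclideanSpace ℂ (Fin n) → M) : Prop where
  smooth : ∃ U : Set (EuclideanSpace ℂ (Fin n)), IsOpen U ∧ closedBall 0 r ⊆ U ∧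
    ContMDiffOn 𝓘(ℝ, EuclideanSpace ℂ (Fin n)) (𝓡 (2 * n)) ∞ e U
  embedding : IsEmbedding ((closedBall (0 : EuclideanSpace ℂ (Fin n)) r).domRestrict e)
  symplectic : ∀ z ∈ closedBall (0 : EuclideanSpace ℂ (Fin n)) r,
    ∀ u v : EuclideanSpace ℂ (Fin n),
      Ω (e z) ![mfderiv 𝓘(ℝ, EuclideanSpace ℂ (Fin n)) (𝓡 (2 * n)) e z u,
        mfderiv 𝓘(ℝ, EuclideanSpace ℂ (Fin n)) (𝓡 (2 * n)) e z v] = stdSymplecticForm u v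

/-- A symplectic embedding `e` of the closed ball of radius `r` is adapted to `L` if
`e⁻¹(L) = B(r) ∩ ℝⁿ`, the preimage being taken in the ball. -/
def IsAdaptedTo {n : ℕ} {M : Type*} (e : EuclideanSpace ℂ (Fin n) → M) (r : ℝ) (L : Set M) :
    Prop :=
  closedBall 0 r ∩ e ⁻¹' L = closedBall 0 r ∩ realPoints n

end

-- The uniform radius comes from a relative Darboux theorem together with translations. Near each
-- point of L, `exists_lagrangian_chart` gives symplectic coordinates in ℂⁿ in which L is ℝⁿ.
-- Translations by real vectors preserve both the standard form and ℝⁿ. Hence one chart, recentred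
-- by translation, serves all nearby points of L with a common radius
-- (`exists_ballEmbedding_of_chart`), and compactness of L leaves finitely many radii to compare.
--
-- For the relative Darboux theorem, a slice chart turns L into a linear subspace Λ and the
-- symplectic form into a form B near 0. Moser's method joins B(0) to B by the path ω_t = B(0) + t(B
-- − B(0)). The radial Poincaré operator gives η with dη = B − B(0), and the flow of the field X_t
-- solving ω_t(X_t, ·) = −η pulls B back to B(0). At points of Λ this η vanishes on Λ, because the
-- radial direction lies in Λ. So X_t is ω_t-orthogonal to Λ, hence tangent to Λ, which is its own
-- orthogonal, and the flow preserves Λ (`exists_moser_diffeo_of_ball`). A symplectic basis adapted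
-- to Λ then makes B(0) standard.
--
-- Smooth dependence of the flow and of η on the point is obtained in the Banach space of continuous
-- paths on [0,1]. Superposition operators are smooth there, and the integral equation of the flow
-- is solved by the inverse function theorem, whose hypothesis is immediate because X vanishes to
-- second order at 0.

universe u

set_option maxSynthPendingDepth 3
set_option linter.unusedSectionVars false

/-! ### Smoothness of superposition operators on spaces of continuous maps -/

section Superposition

variable {K : Type*} [TopologicalSpace K] [CompactSpace K]
  {G F : Type u} [NormedAddCommGroup G] [NormedSpace ℝ G] [NormedAddCommGroup F] [NormedSpace ℝ F]

/-- Pointwise application of a continuous family of continuous linear maps. -/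
noncomputable def pointwiseApplyCLM (K : Type*) [TopologicalSpace K] [CompactSpace K]
    (G F : Type u) [NormedAddCommGroup G] [NormedSpace ℝ G] [NormedAddCommGroup F]
    [NormedSpace ℝ F] : C(K, G →L[ℝ] F) →L[ℝ] C(K, G) →L[ℝ] C(K, F) :=
  LinearMap.mkContinuous₂
    (LinearMap.mk₂ ℝ (fun (A : C(K, G →L[ℝ] F)) (h : C(K, G)) =>
        (⟨fun k => A k (h k), by fun_prop⟩ : C(K, F)))
      (fun _ _ _ => by ext; simp) (fun _ _ _ => by ext; simp)
      (fun _ _ _ => by ext; simp) (fun _ _ _ => by ext; simp)) 1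
    (fun A h => by
      rw [ContinuousMap.norm_le _ (by positivity)]
      intro k
      simp only [LinearMap.mk₂_apply, ContinuousMap.coe_mk, one_mul]
      exact (A k).le_of_opNorm_le_of_le (A.norm_coe_le_norm k) (h.norm_coe_le_norm k))

/-- Apply the mean value inequality pointwise on the segment from `γ k` to `η k`. The bound is
uniform in `k` because composition with `f'` is continuous for the sup norm, and the points of these
segments are values of the maps `γ + s • (η - γ)`, which stay within `δ` of `γ`. -/
theorem hasFDerivAt_superposition (f : C(G, F)) (f' : C(G, G →L[ℝ] F))
    (hf : ∀ y, HasFDerivAt f (f' y) y) (γ : C(K, G)) :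
    HasFDerivAt (fun η : C(K, G) => f.comp η) (pointwiseApplyCLM K G F (f'.comp γ)) γ := by
  rw [hasFDerivAt_iff_isLittleO, Asymptotics.isLittleO_iff]
  intro ε hε
  have hc : Continuous (fun η : C(K, G) => f'.comp η) := ContinuousMap.continuous_postcomp f'
  obtain ⟨δ, hδ, h⟩ := (Metric.continuous_iff (α := C(K, G)) (β := C(K, G →L[ℝ] F))).1 hc γ ε hε
  filter_upwards [Metric.ball_mem_nhds γ hδ] with η hη
  rw [ContinuousMap.norm_le _ (by positivity)]
  intro k
  have key : ‖f (η k) - f (γ k) - (f' (γ k)) (η k - γ k)‖ ≤ ε * ‖η k - γ k‖ := by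
    refine Convex.norm_image_sub_le_of_norm_hasFDerivWithin_le' (𝕜 := ℝ) (f' := f')
      (s := segment ℝ (γ k) (η k)) (fun z _ => (hf z).hasFDerivWithinAt) ?_
      (convex_segment _ _) (left_mem_segment _ _ _) (right_mem_segment _ _ _)
    intro z hz
    rw [segment_eq_image'] at hz
    obtain ⟨s, hs, rfl⟩ := hz
    have h1 : dist (γ + s • (η - γ)) γ < δ := by
      rw [dist_eq_norm, add_sub_cancel_left, norm_smul, Real.norm_of_nonneg hs.1]
      calc s * ‖η - γ‖ ≤ 1 * ‖η - γ‖ := by gcongr; exact hs.2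
        _ < δ := by rw [one_mul, ← dist_eq_norm]; exact hη
    have h2 := (h _ h1).le
    rw [← dist_eq_norm]
    exact (ContinuousMap.dist_apply_le_dist k).trans h2
  calc _ ≤ ε * ‖η k - γ k‖ := key
    _ ≤ ε * ‖η - γ‖ := by gcongr; exact (η - γ).norm_coe_le_norm k

/-- The derivative is the superposition operator of `fderiv ℝ f` followed by a bounded linear map,
so induction on the order works once the target is generalized. The target changes from `F` to `G
→L[ℝ] F`, which is why both spaces share a universe. -/
theorem contDiff_superposition (f : C(G, F)) (hf : ContDiff ℝ ∞ f) :
    ContDiff ℝ ∞ (fun η : C(K, G) => f.comp η) := by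
  rw [contDiff_infty]
  intro n
  induction n generalizing F with
  | zero =>
    exact contDiff_zero.2 (ContinuousMap.continuous_postcomp f)
  | succ n ih =>
    have h1 : ContDiff ℝ ∞ (fderiv ℝ f) := hf.fderiv_right (by simp)
    rw [Nat.cast_succ, contDiff_succ_iff_hasFDerivAt]
    refine ⟨fun γ => pointwiseApplyCLM K G F
      ((⟨fderiv ℝ f, h1.continuous⟩ : C(G, G →L[ℝ] F)).comp γ), ?_, ?_⟩
    · exact (pointwiseApplyCLM K G F).contDiff.comp (ih ⟨fderiv ℝ f, h1.continuous⟩ h1)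
    · intro γ
      exact hasFDerivAt_superposition f ⟨fderiv ℝ f, h1.continuous⟩
        (fun y => ((hf.differentiable (by simp)) y).hasFDerivAt) γ

end Superposition

/-! ### Integration of paths as a bounded operator -/

section Primitive

open unitInterval MeasureTheory

variable {E : Type u} [NormedAddCommGroup E] [NormedSpace ℝ E]

/-- Extension of a path by constants to the real line. -/
noncomputable def pathExtend (g : C(I, E)) : C(ℝ, E) :=
  g.comp ⟨projIcc (0 : ℝ) 1 zero_le_one, continuous_projIcc⟩

theorem pathExtend_of_mem (g : C(I, E)) {t : ℝ} (ht : t ∈ Icc (0 : ℝ) 1) :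
    pathExtend g t = g ⟨t, ht⟩ := by
  simp [pathExtend, projIcc_of_mem _ ht]

theorem norm_pathExtend_le (g : C(I, E)) (t : ℝ) : ‖pathExtend g t‖ ≤ ‖g‖ :=
  g.norm_coe_le_norm _

theorem pathExtend_add (g h : C(I, E)) (t : ℝ) :
    pathExtend (g + h) t = pathExtend g t + pathExtend h t := rfl

theorem pathExtend_smul (c : ℝ) (g : C(I, E)) (t : ℝ) :
    pathExtend (c • g) t = c • pathExtend g t := rfl

variable [CompleteSpace E]

theorem hasDerivAt_integral_pathExtend (g : C(I, E)) (t : ℝ) :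
    HasDerivAt (fun t => ∫ s in (0 : ℝ)..t, pathExtend g s) (pathExtend g t) t :=
  (pathExtend g).continuous.integral_hasStrictDerivAt 0 t |>.hasDerivAt

/-- The operator taking a path to its primitive vanishing at `0`. -/
noncomputable def primitiveCLM (E : Type u) [NormedAddCommGroup E] [NormedSpace ℝ E]
    [CompleteSpace E] : C(I, E) →L[ℝ] C(I, E) :=
  LinearMap.mkContinuous
    { toFun := fun g => ⟨fun t => ∫ s in (0 : ℝ)..t, pathExtend g s,
        (continuous_iff_continuousAt.2 fun t =>
          (hasDerivAt_integral_pathExtend g t).continuousAt).comp continuous_subtype_val⟩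
      map_add' := fun g h => by
        ext t
        simp only [ContinuousMap.coe_mk, pathExtend_add, ContinuousMap.add_apply]
        exact intervalIntegral.integral_add ((pathExtend g).continuous.intervalIntegrable _ _)
          ((pathExtend h).continuous.intervalIntegrable _ _)
      map_smul' := fun c g => by
        ext t
        simp [pathExtend_smul] } 1
    (fun g => by
      rw [ContinuousMap.norm_le _ (by positivity)]
      intro t
      have h := intervalIntegral.norm_integral_le_of_norm_le_const (a := (0 : ℝ)) (b := t)
        (f := pathExtend g) (C := ‖g‖) (fun s _ => norm_pathExtend_le g s)
      refine h.trans ?_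
      rw [mul_comm, sub_zero, abs_of_nonneg t.2.1]
      exact mul_le_mul_of_nonneg_right t.2.2 (norm_nonneg _))

theorem primitiveCLM_apply (g : C(I, E)) (t : I) :
    primitiveCLM E g t = ∫ s in (0 : ℝ)..t, pathExtend g s := rfl

end Primitive

/-! ### Globalizing maps by cutoff -/

section Cutoff

variable {G F : Type*} [NormedAddCommGroup G] [NormedSpace ℝ G] [FiniteDimensional ℝ G]
  [NormedAddCommGroup F] [NormedSpace ℝ F]

/-- A smooth map on a neighbourhood of a compact set agrees, near that set, with a map that is
smooth on the whole space. -/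
theorem exists_contDiff_eqOn_of_isCompact {f : G → F} {U K : Set G} (hU : IsOpen U)
    (hf : ContDiffOn ℝ ∞ f U) (hK : IsCompact K) (hKU : K ⊆ U) :
    ∃ g : G → F, ContDiff ℝ ∞ g ∧ ∃ V, IsOpen V ∧ K ⊆ V ∧ V ⊆ U ∧ EqOn g f V := by
  have : ProperSpace G := FiniteDimensional.proper ℝ G
  obtain ⟨χ, h0, h1, -⟩ := exists_contMDiffMap_zero_one_nhds_of_isClosed (n := (⊤ : ℕ∞))
    𝓘(ℝ, G) (s := Uᶜ) (t := K) hU.isClosed_compl hK.isClosed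
    (disjoint_left.2 fun x hx hx' => hx (hKU hx'))
  have hχ : ContDiff ℝ ∞ χ := χ.contMDiff.contDiff
  refine ⟨fun x => χ x • f x, ?_, ?_⟩
  · rw [contDiff_iff_contDiffAt]
    intro x
    by_cases hx : x ∈ U
    · exact hχ.contDiffAt.smul ((hf x hx).contDiffAt (hU.mem_nhds hx))
    · refine (contDiffAt_const (c := (0 : F))).congr_of_eventuallyEq ?_
      filter_upwards [(eventually_nhdsSet_iff_forall.1 h0) x hx] with y hy
      simp [hy]
  · obtain ⟨V, hV, hKV, hV1⟩ := mem_nhdsSet_iff_exists.1 h1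
    refine ⟨V ∩ U, hV.inter hU, subset_inter hKV hKU, inter_subset_right, fun x hx => ?_⟩
    have : χ x = 1 := hV1 hx.1
    simp [this]

end Cutoff

/-! ### Time-dependent superposition -/

section TimeDependent

open unitInterval

variable {E F : Type u} [NormedAddCommGroup E] [NormedSpace ℝ E]
  [NormedAddCommGroup F] [NormedSpace ℝ F]

/-- The constant path, as a continuous linear map. -/
noncomputable def constPathCLM (E : Type u) [NormedAddCommGroup E] [NormedSpace ℝ E] :
    E →L[ℝ] C(I, E) :=
  LinearMap.mkContinuous
    { toFun := fun x => ContinuousMap.const I x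
      map_add' := fun _ _ => rfl
      map_smul' := fun _ _ => rfl } 1
    (fun x => by
      rw [ContinuousMap.norm_le _ (by positivity)]
      intro t
      exact (one_mul ‖x‖).ge)

/-- Evaluation of a path at time `t`, as a continuous linear map. -/
noncomputable def evalPathCLM (E : Type u) [NormedAddCommGroup E] [NormedSpace ℝ E] (t : I) :
    C(I, E) →L[ℝ] E :=
  LinearMap.mkContinuous
    { toFun := fun γ => γ t
      map_add' := fun _ _ => rfl
      map_smul' := fun _ _ => rfl } 1
    (fun γ => by simpa using γ.norm_coe_le_norm t)

@[simp] theorem evalPathCLM_apply (γ : C(I, E)) (t : I) : evalPathCLM E t γ = γ t := rfl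

/-- The path `t ↦ (t, γ t)`. -/
def graphPath (γ : C(I, E)) : C(I, ℝ × E) := ⟨fun t => ((t : ℝ), γ t), by fun_prop⟩

theorem graphPath_eq (γ : C(I, E)) :
    graphPath γ = graphPath 0 + (ContinuousLinearMap.inr ℝ ℝ E).compLeftContinuous ℝ I γ := by
  ext t <;> simp [graphPath]

theorem hasFDerivAt_graphPath (γ : C(I, E)) :
    HasFDerivAt graphPath ((ContinuousLinearMap.inr ℝ ℝ E).compLeftContinuous ℝ I) γ := by
  have : (graphPath : C(I, E) → C(I, ℝ × E)) =
    fun γ => graphPath 0 + (ContinuousLinearMap.inr ℝ ℝ E).compLeftContinuous ℝ I γ :=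
    funext graphPath_eq
  rw [this]
  exact (((ContinuousLinearMap.inr ℝ ℝ E).compLeftContinuous ℝ I).hasFDerivAt).const_add _

theorem contDiff_graphPath : ContDiff ℝ ∞ (graphPath : C(I, E) → C(I, ℝ × E)) := by
  have : (graphPath : C(I, E) → C(I, ℝ × E)) =
    fun γ => graphPath 0 + (ContinuousLinearMap.inr ℝ ℝ E).compLeftContinuous ℝ I γ :=
    funext graphPath_eq
  rw [this]
  exact contDiff_const.add (ContinuousLinearMap.contDiff _)

/-- The superposition operator `γ ↦ f (t, γ t)` of a time-dependent map. -/
def timeSuperposition (f : C(ℝ × E, F)) (γ : C(I, E)) : C(I, F) := f.comp (graphPath γ)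

@[simp] theorem timeSuperposition_apply (f : C(ℝ × E, F)) (γ : C(I, E)) (t : I) :
    timeSuperposition f γ t = f (t, γ t) := rfl

variable {f : C(ℝ × E, F)}

theorem contDiff_timeSuperposition (hf : ContDiff ℝ ∞ f) :
    ContDiff ℝ ∞ (timeSuperposition f) :=
  (contDiff_superposition f hf).comp contDiff_graphPath

theorem fderiv_timeSuperposition_apply (hf : ContDiff ℝ ∞ f) (γ h : C(I, E)) (t : I) :
    fderiv ℝ (timeSuperposition f) γ h t = fderiv ℝ f (t, γ t) (0, h t) := by
  have h1 := hasFDerivAt_superposition (K := I) f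
    ⟨fderiv ℝ f, (hf.fderiv_right (m := ∞) (by simp)).continuous⟩
    (fun y => ((hf.differentiable (by simp)) y).hasFDerivAt) (graphPath γ)
  have h2 : HasFDerivAt (timeSuperposition f) _ γ := h1.comp γ (hasFDerivAt_graphPath γ)
  rw [h2.fderiv]
  rfl

end TimeDependent

/-! ### Poincaré lemma by the radial homotopy operator -/

section Poincare

open unitInterval

variable {E : Type u} [NormedAddCommGroup E] [NormedSpace ℝ E]

/-- The integrand of the radial homotopy operator on 2-forms. -/
noncomputable def radialIntegrand (τ : E → E →L[ℝ] E →L[ℝ] ℝ) (p : ℝ × E) : E →L[ℝ] ℝ :=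
  p.1 • τ (p.1 • p.2) p.2

theorem contDiff_radialIntegrand {τ : E → E →L[ℝ] E →L[ℝ] ℝ} (hτ : ContDiff ℝ ∞ τ) :
    ContDiff ℝ ∞ (radialIntegrand τ) := by
  unfold radialIntegrand
  exact contDiff_fst.smul ((hτ.comp (contDiff_fst.smul contDiff_snd)).clm_apply contDiff_snd)

theorem fderiv_radialIntegrand_apply {τ : E → E →L[ℝ] E →L[ℝ] ℝ} (hτ : ContDiff ℝ ∞ τ)
    (t : ℝ) (x h v : E) :
    fderiv ℝ (radialIntegrand τ) (t, x) (0, h) v =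
      t ^ 2 * fderiv ℝ τ (t • x) h x v + t * τ (t • x) h v := by
  have h1 : HasFDerivAt τ (fderiv ℝ τ (t • x)) (t • x) :=
    ((hτ.differentiable (by simp)) _).hasFDerivAt
  have h2 : HasFDerivAt (fun y : E => t • τ (t • y) y) _ x :=
    (((h1.comp x ((hasFDerivAt_id x).const_smul t)).clm_apply (hasFDerivAt_id x)).const_smul t)
  have h3 : HasFDerivAt (radialIntegrand τ) _ (t, x) :=
    ((contDiff_radialIntegrand hτ).differentiable (by simp) (t, x)).hasFDerivAt
  have h4 : HasFDerivAt (fun y : E => (t, y)) (ContinuousLinearMap.inr ℝ ℝ E) x :=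
    hasFDerivAt_prodMk_right t x
  have h5 := (h3.comp x h4).unique h2
  have h6 := congrArg (fun A => A h v) h5
  simp only [ContinuousLinearMap.comp_apply, ContinuousLinearMap.inr_apply] at h6
  rw [h6]
  simp
  ring

/-- The radial primitive of a 2-form. -/
noncomputable def radialPrimitive (τ : E → E →L[ℝ] E →L[ℝ] ℝ) (hτ : ContDiff ℝ ∞ τ) (x : E) :
    E →L[ℝ] ℝ :=
  evalPathCLM _ 1 (primitiveCLM _
    (timeSuperposition ⟨radialIntegrand τ, (contDiff_radialIntegrand hτ).continuous⟩
      (constPathCLM E x)))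

variable {τ : E → E →L[ℝ] E →L[ℝ] ℝ} (hτ : ContDiff ℝ ∞ τ)

/-- The parameter integral is a smooth superposition operator composed with bounded linear maps, so
no separate argument for differentiating under the integral is needed. -/
theorem contDiff_radialPrimitive : ContDiff ℝ ∞ (radialPrimitive τ hτ) :=
  (evalPathCLM (E →L[ℝ] ℝ) 1).contDiff.comp ((primitiveCLM (E →L[ℝ] ℝ)).contDiff.comp
    ((contDiff_timeSuperposition (f := ⟨radialIntegrand τ, _⟩) (contDiff_radialIntegrand hτ)).comp
      (constPathCLM E).contDiff))

theorem integral_pathExtend_congr {F : Type u} [NormedAddCommGroup F] [NormedSpace ℝ F]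
    (g : C(I, F)) (k : ℝ → F) (h : ∀ t : I, g t = k t) :
    ∫ s in (0 : ℝ)..1, pathExtend g s = ∫ s in (0 : ℝ)..1, k s := by
  refine intervalIntegral.integral_congr fun s hs => ?_
  rw [uIcc_of_le zero_le_one] at hs
  rw [pathExtend_of_mem _ hs, h]

theorem radialPrimitive_apply (x v : E) :
    radialPrimitive τ hτ x v = ∫ t in (0 : ℝ)..1, t * τ (t • x) x v := by
  have hc : Continuous (fun t : ℝ => radialIntegrand τ (t, x)) :=
    (contDiff_radialIntegrand hτ).continuous.comp (by fun_prop)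
  rw [radialPrimitive, evalPathCLM_apply, primitiveCLM_apply, Set.Icc.coe_one,
    integral_pathExtend_congr _ (fun t : ℝ => radialIntegrand τ (t, x)) (fun t => rfl),
    ContinuousLinearMap.intervalIntegral_apply (hc.intervalIntegrable _ _)]
  rfl

theorem fderiv_radialPrimitive_apply (x h v : E) :
    fderiv ℝ (radialPrimitive τ hτ) x h v =
      ∫ t in (0 : ℝ)..1, (t ^ 2 * fderiv ℝ τ (t • x) h x v + t * τ (t • x) h v) := by
  set f : C(ℝ × E, E →L[ℝ] ℝ) :=
    ⟨radialIntegrand τ, (contDiff_radialIntegrand hτ).continuous⟩ with hf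
  have hfd : ContDiff ℝ ∞ f := contDiff_radialIntegrand hτ
  have h1 : HasFDerivAt (timeSuperposition f) _ (constPathCLM E x) :=
    ((contDiff_timeSuperposition hfd).differentiable (by simp) _).hasFDerivAt
  have h2 : HasFDerivAt (radialPrimitive τ hτ) _ x :=
    (evalPathCLM (E →L[ℝ] ℝ) 1).hasFDerivAt.comp x
      ((primitiveCLM (E →L[ℝ] ℝ)).hasFDerivAt.comp x
      (h1.comp x (constPathCLM E).hasFDerivAt))
  have hc : Continuous (fun t : ℝ => fderiv ℝ f (t, x) (0, h)) :=
    ((hfd.fderiv_right (m := ∞) (by simp)).continuous.comp (by fun_prop)).clm_apply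
      continuous_const
  rw [h2.fderiv]
  simp only [ContinuousLinearMap.comp_apply, evalPathCLM_apply]
  rw [primitiveCLM_apply, Set.Icc.coe_one,
    integral_pathExtend_congr _ (fun t : ℝ => fderiv ℝ f (t, x) (0, h))
      (fun t => fderiv_timeSuperposition_apply hfd _ _ t),
    ContinuousLinearMap.intervalIntegral_apply (hc.intervalIntegrable _ _)]
  refine intervalIntegral.integral_congr fun t _ => ?_
  exact fderiv_radialIntegrand_apply hτ t x h v

/-- The Poincaré lemma for 2-forms, at points whose segment to the origin lies in a region where
the form is closed. -/
theorem fderiv_radialPrimitive_sub (x u v : E)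
    (hanti : ∀ t ∈ Icc (0 : ℝ) 1, ∀ a b, τ (t • x) a b = -τ (t • x) b a)
    (hcl : ∀ t ∈ Icc (0 : ℝ) 1, ∀ a b c, fderiv ℝ τ (t • x) a b c - fderiv ℝ τ (t • x) b a c +
      fderiv ℝ τ (t • x) c a b = 0) :
    fderiv ℝ (radialPrimitive τ hτ) x u v - fderiv ℝ (radialPrimitive τ hτ) x v u = τ x u v := by
  have hτ' : Continuous (fderiv ℝ τ) := (hτ.fderiv_right (m := ∞) (by simp)).continuous
  have hτc := hτ.continuous
  rw [fderiv_radialPrimitive_apply, fderiv_radialPrimitive_apply, ← intervalIntegral.integral_sub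
    (Continuous.intervalIntegrable (by fun_prop) _ _)
    (Continuous.intervalIntegrable (by fun_prop) _ _)]
  -- Closedness and antisymmetry turn the integrand of the difference into the derivative of t²
  -- τ(tx)(u, v), whose values at 1 and 0 are τ(x)(u, v) and 0.
  have hd : ∀ t : ℝ, HasDerivAt (fun t : ℝ => t ^ 2 * τ (t • x) u v)
      (2 * t * τ (t • x) u v + t ^ 2 * fderiv ℝ τ (t • x) x u v) t := by
    intro t
    have h1 : HasFDerivAt τ (fderiv ℝ τ (t • x)) (t • x) :=
      ((hτ.differentiable (by simp)) _).hasFDerivAt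
    have h2 : HasDerivAt (fun t : ℝ => t • x) x t := by
      simpa using (hasDerivAt_id t).smul_const x
    have h3 := HasFDerivAt.comp_hasDerivAt (f := fun t : ℝ => t • x) t h1 h2
    have h4 := (h3.clm_apply (hasDerivAt_const t u)).clm_apply (hasDerivAt_const t v)
    simpa using (hasDerivAt_pow 2 t).fun_mul h4
  have hint := intervalIntegral.integral_eq_sub_of_hasDerivAt (a := 0) (b := 1)
    (fun t _ => hd t) (Continuous.intervalIntegrable (by fun_prop) _ _)
  rw [show τ x u v = (1 : ℝ) ^ 2 * τ ((1 : ℝ) • x) u v - (0 : ℝ) ^ 2 * τ ((0 : ℝ) • x) u v by simp,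
    ← hint]
  refine intervalIntegral.integral_congr fun t ht => ?_
  rw [uIcc_of_le zero_le_one] at ht
  have e1 := hcl t ht x u v
  have e2 := hanti t ht v u
  rw [e2]
  linear_combination (-t ^ 2) * e1
end Poincare

/-! ### Inverse function theorem -/

section InverseFunction

variable {E F : Type*} [NormedAddCommGroup E] [NormedSpace ℝ E] [CompleteSpace E]
  [NormedAddCommGroup F] [NormedSpace ℝ F]

/-- The inverse function theorem, with an inverse that is smooth on an open set. -/
theorem exists_smooth_localInverse {f : E → F} {U : Set E} {a : E} (hU : IsOpen U) (ha : a ∈ U)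
    (hf : ContDiffOn ℝ ∞ f U) (f' : E ≃L[ℝ] F) (hf' : HasFDerivAt f (f' : E →L[ℝ] F) a) :
    ∃ e : OpenPartialHomeomorph E F, a ∈ e.source ∧ e.source ⊆ U ∧ (e : E → F) = f ∧
      ContDiffOn ℝ ∞ e.symm e.target ∧
      ∀ x ∈ e.source, ∃ A : E ≃L[ℝ] F, HasFDerivAt f (A : E →L[ℝ] F) x := by
  have hfa : ∀ x ∈ U, ContDiffAt ℝ ∞ f x := fun x hx => (hf x hx).contDiffAt (hU.mem_nhds hx)
  set e₀ := (hfa a ha).toOpenPartialHomeomorph f hf' (by simp) with he₀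
  have he₀f : (e₀ : E → F) = f := (hfa a ha).toOpenPartialHomeomorph_coe hf' (by simp)
  -- Invertibility is an open condition. Restricting the source to points with invertible derivative
  -- makes the inverse smooth on the whole target, not only at the image of `a`.
  have hW : IsOpen (U ∩ fderiv ℝ f ⁻¹' range ((↑) : (E ≃L[ℝ] F) → E →L[ℝ] F)) :=
    (hf.continuousOn_fderiv_of_isOpen hU (by simp)).isOpen_inter_preimage hU
      ContinuousLinearEquiv.isOpen
  set e := e₀.restrOpen _ hW
  have hef : (e : E → F) = f := he₀f
  have hsrc : ∀ x ∈ e.source, x ∈ U ∧ ∃ A : E ≃L[ℝ] F, HasFDerivAt f (A : E →L[ℝ] F) x := by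
    intro x hx
    obtain ⟨-, h2, A, hA⟩ := hx
    refine ⟨h2, A, ?_⟩
    rw [hA]
    exact ((hfa x h2).differentiableAt (by simp)).hasFDerivAt
  refine ⟨e, ⟨(hfa a ha).mem_toOpenPartialHomeomorph_source hf' (by simp), ha,
    f', hf'.fderiv.symm⟩, fun x hx => (hsrc x hx).1, hef, ?_, fun x hx => (hsrc x hx).2⟩
  intro y hy
  obtain ⟨h2, A, hA⟩ := hsrc _ (e.map_target hy)
  exact (e.contDiffAt_symm hy (f₀' := A) (hef.symm ▸ hA)
    (hef.symm ▸ hfa _ h2)).contDiffWithinAt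

end InverseFunction

/-! ### Integral curves up to time 1, smooth in the initial value -/

section Flow

open unitInterval

variable {E : Type u} [NormedAddCommGroup E] [NormedSpace ℝ E] [CompleteSpace E]

/-- Smooth dependence on the initial value for a time-dependent vector field vanishing to second
order at the origin: near the origin, integral curves exist up to time `1`. -/
theorem exists_smooth_integralCurves (X : C(ℝ × E, E)) (hX : ContDiff ℝ ∞ X)
    (h0 : ∀ t ∈ Icc (0 : ℝ) 1, X (t, 0) = 0)
    (h1 : ∀ t ∈ Icc (0 : ℝ) 1, ∀ h, fderiv ℝ X (t, 0) (0, h) = 0) :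
    ∃ (Γ : E → C(I, E)) (V : Set E), IsOpen V ∧ (0 : E) ∈ V ∧ ContDiffOn ℝ ∞ Γ V ∧ Γ 0 = 0 ∧
      HasFDerivAt Γ (constPathCLM E) 0 ∧
      ∀ x ∈ V, Γ x = constPathCLM E x + primitiveCLM E (timeSuperposition X (Γ x)) := by
  -- The integral curve from `x` solves `Ψ γ = constPathCLM E x`. Since X and its space derivative
  -- vanish at the origin, `Ψ` fixes 0 with derivative the identity, and its local inverse gives the
  -- curves.
  set Ψ : C(I, E) → C(I, E) := fun γ => γ - primitiveCLM E (timeSuperposition X γ) with hΨ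
  have hT := contDiff_timeSuperposition hX
  have hΨs : ContDiff ℝ ∞ Ψ := contDiff_id.sub ((primitiveCLM E).contDiff.comp hT)
  have hT0 : timeSuperposition X 0 = 0 := by
    ext t
    simpa using h0 t t.2
  have hDT : fderiv ℝ (timeSuperposition X) 0 = 0 := by
    ext h t
    rw [fderiv_timeSuperposition_apply hX]
    exact h1 t t.2 _
  have hΨ' : HasFDerivAt Ψ ((ContinuousLinearEquiv.refl ℝ C(I, E) : C(I, E) ≃L[ℝ] C(I, E)) :
      C(I, E) →L[ℝ] C(I, E)) 0 := by
    have h2 : HasFDerivAt (timeSuperposition X) (0 : C(I, E) →L[ℝ] C(I, E)) 0 :=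
      hDT ▸ (hT.differentiable (by simp) 0).hasFDerivAt
    have h3 := (hasFDerivAt_id (𝕜 := ℝ) (0 : C(I, E))).sub
      ((primitiveCLM E).hasFDerivAt.comp (0 : C(I, E)) h2)
    refine HasFDerivAt.congr_fderiv h3 ?_
    ext; simp
  obtain ⟨e, h0e, -, hef, hsymm, -⟩ :=
    exists_smooth_localInverse isOpen_univ (mem_univ (0 : C(I, E))) hΨs.contDiffOn _ hΨ'
  have hΨ0 : Ψ 0 = 0 := by simp [hΨ, hT0]
  have he0 : e 0 = 0 := by rw [hef, hΨ0]
  have h0t : (0 : C(I, E)) ∈ e.target := by simpa [he0] using e.map_source h0e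
  have hs0 : e.symm 0 = 0 := by simpa [he0] using e.left_inv h0e
  refine ⟨fun x => e.symm (constPathCLM E x), constPathCLM E ⁻¹' e.target,
    e.open_target.preimage (constPathCLM E).continuous, by simpa using h0t,
    hsymm.comp (constPathCLM E).contDiff.contDiffOn (fun _ h => h), by simpa using hs0, ?_, ?_⟩
  · have h2 : HasFDerivAt e ((ContinuousLinearEquiv.refl ℝ C(I, E) : C(I, E) ≃L[ℝ] C(I, E)) :
      C(I, E) →L[ℝ] C(I, E)) (e.symm 0) := by rw [hs0, hef]; exact hΨ'
    have h3 := e.hasFDerivAt_symm h0t h2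
    rw [← map_zero (constPathCLM E)] at h3
    exact h3.comp (0 : E) (constPathCLM E).hasFDerivAt
  · intro x hx
    have h2 : Ψ (e.symm (constPathCLM E x)) = constPathCLM E x := by
      rw [← hef]; exact e.right_inv hx
    exact sub_eq_iff_eq_add.1 h2

/-- This is the variational equation in integrated form, obtained by differentiating the integral
equation in `x`. -/
theorem fderiv_integralCurves (X : C(ℝ × E, E)) (hX : ContDiff ℝ ∞ X) {Γ : E → C(I, E)}
    {V : Set E} (hV : IsOpen V) (hΓ : ContDiffOn ℝ ∞ Γ V)
    (h : ∀ x ∈ V, Γ x = constPathCLM E x + primitiveCLM E (timeSuperposition X (Γ x)))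
    {x : E} (hx : x ∈ V) (u : E) :
    fderiv ℝ Γ x u = constPathCLM E u +
      primitiveCLM E (fderiv ℝ (timeSuperposition X) (Γ x) (fderiv ℝ Γ x u)) := by
  have h1 : HasFDerivAt Γ (fderiv ℝ Γ x) x :=
    (((hΓ x hx).contDiffAt (hV.mem_nhds hx)).differentiableAt (by simp)).hasFDerivAt
  have h2 : HasFDerivAt (timeSuperposition X) _ (Γ x) :=
    ((contDiff_timeSuperposition hX).differentiable (by simp) _).hasFDerivAt
  have h3 := (constPathCLM E).hasFDerivAt.add ((primitiveCLM E).hasFDerivAt.comp x (h2.comp x h1))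
  have h4 := h1.unique (h3.congr_of_eventuallyEq
    (Filter.eventually_of_mem (hV.mem_nhds hx) fun y hy => h y hy))
  exact congrArg (fun A => A u) h4

/-- A path satisfying an integral equation extends to a differentiable curve on the line. -/
theorem exists_hasDerivAt_of_eq_primitive {γ g : C(I, E)} {x : E}
    (h : γ = constPathCLM E x + primitiveCLM E g) :
    ∃ c : ℝ → E, (∀ t, HasDerivAt c (pathExtend g t) t) ∧ c 0 = x ∧ ∀ t : I, c t = γ t := by
  refine ⟨fun t => x + ∫ s in (0 : ℝ)..t, pathExtend g s,
    fun t => (hasDerivAt_integral_pathExtend g t).const_add x, by simp, fun t => ?_⟩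
  rw [h]
  rfl

end Flow

/-! ### Lagrangian subspaces are their own orthogonals -/

section IsotropicSubspace

variable {E : Type*} [NormedAddCommGroup E] [NormedSpace ℝ E] [FiniteDimensional ℝ E]

/-- Pairing with a nondegenerate form maps onto the dual of any subspace. -/
theorem exists_forall_apply_eq {β : E →L[ℝ] E →L[ℝ] ℝ}
    (hnd : ∀ v, (∀ w, β v w = 0) → v = 0) (Λ : Submodule ℝ E) (f : Module.Dual ℝ Λ) :
    ∃ u, ∀ v : Λ, β u v = f v := by
  set T : E →ₗ[ℝ] Module.Dual ℝ E := ContinuousLinearMap.coeLM ℝ ∘ₗ (β : E →ₗ[ℝ] E →L[ℝ] ℝ)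
  have hT : Function.Injective T := (injective_iff_map_eq_zero T).2 fun v hv =>
    hnd v fun w => congrArg (fun g : Module.Dual ℝ E => g w) hv
  have hT' : Function.Surjective T :=
    (LinearMap.injective_iff_surjective_of_finrank_eq_finrank
      (Subspace.dual_finrank_eq).symm).1 hT
  obtain ⟨g, hg⟩ := LinearMap.exists_extend f
  obtain ⟨u, hu⟩ := hT' g
  exact ⟨u, fun v => (congrArg (fun g : Module.Dual ℝ E => g v) hu).trans
    (congrArg (fun g : Module.Dual ℝ Λ => g v) hg)⟩

/-- An isotropic subspace of half the dimension contains its symplectic orthogonal. -/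
theorem mem_of_forall_apply_eq_zero {β : E →L[ℝ] E →L[ℝ] ℝ}
    (hnd : ∀ v, (∀ w, β v w = 0) → v = 0) {Λ : Submodule ℝ E}
    (hdim : Module.finrank ℝ E = 2 * Module.finrank ℝ Λ)
    (hiso : ∀ u ∈ Λ, ∀ v ∈ Λ, β u v = 0) {u : E} (hu : ∀ v ∈ Λ, β u v = 0) : u ∈ Λ := by
  set T : E →ₗ[ℝ] Module.Dual ℝ Λ :=
    Λ.subtype.dualMap ∘ₗ ContinuousLinearMap.coeLM ℝ ∘ₗ (β : E →ₗ[ℝ] E →L[ℝ] ℝ)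
  have hT : Function.Surjective T := fun f => by
    obtain ⟨u, hu⟩ := exists_forall_apply_eq hnd Λ f
    exact ⟨u, LinearMap.ext hu⟩
  -- The kernel of `T` is the orthogonal of Λ. It contains Λ, and surjectivity of `T` gives it
  -- dimension dim E − dim Λ = dim Λ.
  have h1 := LinearMap.finrank_range_add_finrank_ker T
  rw [LinearMap.range_eq_top.2 hT, finrank_top, Subspace.dual_finrank_eq] at h1
  have h2 : Λ ≤ LinearMap.ker T := fun x hx => LinearMap.ext fun v => hiso x hx v v.2
  have h3 : Λ = LinearMap.ker T := Submodule.eq_of_le_of_finrank_eq h2 (by omega)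
  rw [h3]
  exact LinearMap.ext fun v => hu v v.2

end IsotropicSubspace

/-! ### Flows of fields tangent to a subspace -/

section Invariance

variable {E : Type u} [NormedAddCommGroup E] [NormedSpace ℝ E] [FiniteDimensional ℝ E]

/-- Integral curves of a vector field tangent to a subspace neither enter nor leave it. -/
theorem mem_submodule_iff_of_integralCurve {X : ℝ × E → E} (hX : ContDiff ℝ ∞ X)
    (Λ : Submodule ℝ E) {δ : ℝ} (hδ : 0 < δ)
    (htan : ∀ t ∈ Icc (0 : ℝ) 1, ∀ x ∈ ball (0 : E) δ, x ∈ Λ → X (t, x) ∈ Λ) :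
    ∃ δ' > 0, ∀ c : ℝ → E, (∀ t ∈ Icc (0 : ℝ) 1, HasDerivAt c (X (t, c t)) t) →
      (∀ t ∈ Icc (0 : ℝ) 1, c t ∈ ball (0 : E) δ') → (c 1 ∈ Λ ↔ c 0 ∈ Λ) := by
  obtain ⟨Λ', hΛ'⟩ := Submodule.exists_isCompl Λ
  set Q : E →L[ℝ] E := LinearMap.toContinuousLinearMap
    (Λ.subtype ∘ₗ Submodule.projectionOnto Λ Λ' hΛ')
  have hQmem : ∀ x, Q x ∈ Λ := fun x => (Submodule.projectionOnto Λ Λ' hΛ' x).2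
  have hQid : ∀ x ∈ Λ, Q x = x := fun x hx =>
    congrArg Subtype.val (Submodule.projectionOnto_apply_left hΛ' ⟨x, hx⟩)
  set P : E →L[ℝ] E := ContinuousLinearMap.id ℝ E - Q
  have hPapp : ∀ x, P x = x - Q x := fun x => rfl
  have hP : ∀ x, P x = 0 ↔ x ∈ Λ := fun x =>
    ⟨fun h => by rw [sub_eq_zero.1 ((hPapp x).symm.trans h)]; exact hQmem x,
      fun h => by rw [hPapp, hQid x h, sub_self]⟩
  have := FiniteDimensional.proper ℝ E
  obtain ⟨C, hC⟩ : ∃ C : ℝ, ∀ p ∈ Icc (0 : ℝ) 1 ×ˢ closedBall (0 : E) δ, ‖fderiv ℝ X p‖ ≤ C :=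
    (isCompact_Icc.prod (isCompact_closedBall 0 δ)).exists_bound_of_continuousOn
      (hX.fderiv_right (m := ∞) (by simp)).continuous.continuousOn
  have hC0 : 0 ≤ C := (norm_nonneg _).trans (hC (0, 0) ⟨by simp, by simp [hδ.le]⟩)
  -- At `Q x ∈ Λ` the field is tangent to Λ, so `P` kills it there. The Lipschitz bound then
  -- controls the transverse part of X at `x` by the distance `‖P x‖` to `Q x`, as Grönwall's
  -- inequality requires.
  have hest : ∀ t ∈ Icc (0 : ℝ) 1, ∀ x ∈ ball (0 : E) δ, Q x ∈ ball (0 : E) δ →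
      ‖P (X (t, x))‖ ≤ ‖P‖ * C * ‖P x‖ := by
    intro t ht x hx hQx
    have h1 : ‖X (t, x) - X (t, Q x)‖ ≤ C * ‖(t, x) - (t, Q x)‖ := by
      refine Convex.norm_image_sub_le_of_norm_fderiv_le (𝕜 := ℝ)
        (s := Icc (0 : ℝ) 1 ×ˢ closedBall (0 : E) δ)
        (fun p _ => hX.differentiable (by simp) p) hC
        ((convex_Icc 0 1).prod (convex_closedBall 0 δ))
        ⟨ht, ball_subset_closedBall hQx⟩ ⟨ht, ball_subset_closedBall hx⟩
    have h2 : P (X (t, x)) = P (X (t, x) - X (t, Q x)) := by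
      rw [map_sub, (hP _).2 (htan t ht _ hQx (hQmem x)), sub_zero]
    have h3 : ‖(t, x) - (t, Q x)‖ = ‖P x‖ := by simp [hPapp, Prod.norm_def]
    rw [h2, mul_assoc]
    exact (P.le_opNorm _).trans (by rw [h3] at h1; gcongr)
  have hQ0 : Filter.Tendsto Q (𝓝 0) (𝓝 0) := by simpa using Q.continuous.tendsto 0
  obtain ⟨δ', hδ', hball⟩ := Metric.mem_nhds_iff.1
    (Filter.inter_mem (ball_mem_nhds (0 : E) hδ) (hQ0 (ball_mem_nhds (0 : E) hδ)))
  refine ⟨δ', hδ', fun c hc hcb => ?_⟩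
  have hPc : ∀ t ∈ Icc (0 : ℝ) 1, HasDerivAt (fun t => P (c t)) (P (X (t, c t))) t :=
    fun t ht => P.hasFDerivAt.comp_hasDerivAt t (hc t ht)
  have hbd : ∀ t ∈ Icc (0 : ℝ) 1, ‖P (X (t, c t))‖ ≤ ‖P‖ * C * ‖P (c t)‖ + 0 := fun t ht => by
    rw [add_zero]
    exact hest t ht _ (hball (hcb t ht)).1 (hball (hcb t ht)).2
  rw [← hP, ← hP]
  constructor
  -- For this direction Grönwall is applied to the curve run backwards from time 1.
  · intro h1
    have hrev : ∀ t ∈ Icc (0 : ℝ) 1, (1 - t) ∈ Icc (0 : ℝ) 1 :=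
      fun t ht => ⟨by linarith [ht.2], by linarith [ht.1]⟩
    have hd : ∀ t ∈ Icc (0 : ℝ) 1, HasDerivAt (fun t => P (c (1 - t)))
        (-P (X (1 - t, c (1 - t)))) t := fun t ht => by
      have := (hPc _ (hrev t ht)).scomp t ((hasDerivAt_id t).const_sub 1)
      simpa [Function.comp_def] using this
    have := norm_le_gronwallBound_of_norm_deriv_right_le (δ := 0) (K := ‖P‖ * C) (ε := 0)
      (fun t ht => (hd t ht).continuousAt.continuousWithinAt)
      (fun t ht => (hd t (Ico_subset_Icc_self ht)).hasDerivWithinAt) (by simp [h1])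
      (fun t ht => by rw [norm_neg]; exact hbd _ (hrev t (Ico_subset_Icc_self ht))) 1 (by simp)
    simpa [gronwallBound_ε0_δ0] using this
  · intro h0
    have := norm_le_gronwallBound_of_norm_deriv_right_le (δ := 0) (K := ‖P‖ * C) (ε := 0)
      (fun t ht => (hPc t ht).continuousAt.continuousWithinAt)
      (fun t ht => (hPc t (Ico_subset_Icc_self ht)).hasDerivWithinAt) (by simp [h0])
      (fun t ht => hbd _ (Ico_subset_Icc_self ht)) 1 (by simp)
    simpa [gronwallBound_ε0_δ0] using this

end Invariance

/-! ### The Moser vector field -/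

section MoserField

variable {E : Type u} [NormedAddCommGroup E] [NormedSpace ℝ E] [FiniteDimensional ℝ E]

/-- The linear path of 2-forms from the value at the origin to the given form. -/
noncomputable def moserPath (B : E → E →L[ℝ] E →L[ℝ] ℝ) (p : ℝ × E) : E →L[ℝ] E →L[ℝ] ℝ :=
  B 0 + p.1 • (B p.2 - B 0)

theorem contDiff_moserPath {B : E → E →L[ℝ] E →L[ℝ] ℝ} (hB : ContDiff ℝ ∞ B) :
    ContDiff ℝ ∞ (moserPath B) :=
  contDiff_const.add (contDiff_fst.smul ((hB.comp contDiff_snd).sub contDiff_const))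

/-- At the origin every form of the path equals `B 0`, so the path is invertible near the compact
set [0,1] × {0}. The tube lemma gives one `δ` for all times, and a cutoff makes the field global. -/
theorem exists_moserField {B : E → E →L[ℝ] E →L[ℝ] ℝ} (hB : ContDiff ℝ ∞ B)
    (hnd : ∀ v, (∀ w, B 0 v w = 0) → v = 0) {σ : E → E →L[ℝ] ℝ} (hσ : ContDiff ℝ ∞ σ) :
    ∃ X : C(ℝ × E, E), ContDiff ℝ ∞ X ∧ ∃ δ > 0, ∀ t ∈ Icc (0 : ℝ) 1, ∀ x ∈ ball (0 : E) δ,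
      (∀ v, moserPath B (t, x) v = 0 → v = 0) ∧ moserPath B (t, x) (X (t, x)) = -σ x := by
  have hω := contDiff_moserPath hB
  set W : Set (ℝ × E) :=
    moserPath B ⁻¹' range ((↑) : (E ≃L[ℝ] (E →L[ℝ] ℝ)) → E →L[ℝ] E →L[ℝ] ℝ)
  have hW : IsOpen W := ContinuousLinearEquiv.isOpen.preimage hω.continuous
  have hinj : Function.Injective (B 0 : E →ₗ[ℝ] E →L[ℝ] ℝ) :=
    (injective_iff_map_eq_zero _).2 fun v hv =>
      hnd v fun w => congrArg (fun g : E →L[ℝ] ℝ => g w) hv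
  have hfin : Module.finrank ℝ E = Module.finrank ℝ (E →L[ℝ] ℝ) := by
    rw [← (LinearMap.toContinuousLinearMap (𝕜 := ℝ) (E := E) (F' := ℝ)).finrank_eq]
    exact (Subspace.dual_finrank_eq (K := ℝ) (V := E)).symm
  have hKW : Icc (0 : ℝ) 1 ×ˢ {(0 : E)} ⊆ W := by
    rintro ⟨t, x⟩ ⟨-, rfl⟩
    refine ⟨(LinearEquiv.ofInjectiveOfFinrankEq _ hinj hfin).toContinuousLinearEquiv, ?_⟩
    ext v w
    simp only [moserPath, sub_self, smul_zero, add_zero]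
    rfl
  -- `inverse` is 0 at non-invertible maps; only its values on `W` are used.
  set f : ℝ × E → E := fun p => -(moserPath B p).inverse (σ p.2)
  have hf : ContDiffOn ℝ ∞ f W := by
    rintro p ⟨A, hA⟩
    have h1 : ContDiffAt ℝ ∞ (fun p => (moserPath B p).inverse) p := by
      refine ContDiffAt.comp (g := ContinuousLinearMap.inverse) p ?_ hω.contDiffAt
      rw [← hA]
      exact contDiffAt_map_inverse A
    exact (h1.clm_apply (hσ.comp contDiff_snd).contDiffAt).neg.contDiffWithinAt
  obtain ⟨X, hX, V, hV, hKV, hVW, hXf⟩ := exists_contDiff_eqOn_of_isCompact hW hf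
    (isCompact_Icc.prod isCompact_singleton) hKW
  obtain ⟨u, v, hu, hv, hIu, h0v, huv⟩ := generalized_tube_lemma isCompact_Icc
    isCompact_singleton hV hKV
  obtain ⟨δ, hδ, hball⟩ := Metric.mem_nhds_iff.1 (hv.mem_nhds (h0v rfl))
  refine ⟨⟨X, hX.continuous⟩, hX, δ, hδ, fun t ht x hx => ?_⟩
  have hmem : (t, x) ∈ V := huv ⟨hIu ht, hball hx⟩
  obtain ⟨A, hA⟩ := hVW hmem
  refine ⟨fun v hv => ?_, ?_⟩
  · rw [← hA] at hv
    exact A.map_eq_zero_iff.1 hv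
  · rw [ContinuousMap.coe_mk, hXf hmem]
    simp only [f]
    rw [← hA, ContinuousLinearMap.inverse_equiv]
    simp

end MoserField

/-! ### Moser's argument relative to a Lagrangian subspace -/

section Moser

open unitInterval

variable {E : Type u} [NormedAddCommGroup E] [NormedSpace ℝ E] [FiniteDimensional ℝ E]

/-- Closedness at `x` of a 2-form given by bilinear maps. -/
def IsClosedFormAt (B : E → E →L[ℝ] E →L[ℝ] ℝ) (x : E) : Prop :=
  ∀ a b c, fderiv ℝ B x a b c - fderiv ℝ B x b a c + fderiv ℝ B x c a b = 0

theorem fderiv_slice_apply {F : Type*} [NormedAddCommGroup F] [NormedSpace ℝ F] {f : ℝ × E → F}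
    (hf : ContDiff ℝ ∞ f) (t : ℝ) (x : E) :
    HasFDerivAt (fun y => f (t, y)) (fderiv ℝ f (t, x) ∘L ContinuousLinearMap.inr ℝ ℝ E) x :=
  ((hf.differentiable (by simp)) (t, x)).hasFDerivAt.comp x (hasFDerivAt_prodMk_right t x)

/-- Derivative of the equation defining the Moser vector field. -/
theorem fderiv_moserField {B : E → E →L[ℝ] E →L[ℝ] ℝ} (hB : ContDiff ℝ ∞ B)
    {η : E → E →L[ℝ] ℝ} (hη : ContDiff ℝ ∞ η) {X : ℝ × E → E} (hX : ContDiff ℝ ∞ X)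
    {t δ : ℝ} (h : ∀ x ∈ ball (0 : E) δ, moserPath B (t, x) (X (t, x)) = -η x)
    {x : E} (hx : x ∈ ball (0 : E) δ) (u v : E) :
    t * fderiv ℝ B x u (X (t, x)) v + moserPath B (t, x) (fderiv ℝ X (t, x) (0, u)) v =
      -fderiv ℝ η x u v := by
  have h1 : HasFDerivAt (fun y => moserPath B (t, y)) (t • fderiv ℝ B x) x :=
    (((hB.differentiable (by simp) x).hasFDerivAt.sub_const _).const_smul t).const_add _
  have h2 := h1.clm_apply (fderiv_slice_apply hX t x)
  have h3 : HasFDerivAt (fun y => -η y) (-fderiv ℝ η x) x :=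
    (hη.differentiable (by simp) x).hasFDerivAt.neg
  have h4 := h2.unique (h3.congr_of_eventuallyEq
    (Filter.eventually_of_mem (isOpen_ball.mem_nhds hx) h))
  have h5 := congrArg (fun A => A u v) h4
  simp at h5
  linarith

/-- The pullback of the Moser path of forms along integral curves of the Moser field is
constant. -/
theorem moserPath_integralCurve {B : E → E →L[ℝ] E →L[ℝ] ℝ} (hB : ContDiff ℝ ∞ B) {δ : ℝ}
    (hanti : ∀ x ∈ ball (0 : E) δ, ∀ a b, B x a b = -B x b a)
    (hcl : ∀ x ∈ ball (0 : E) δ, IsClosedFormAt B x)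
    {η : E → E →L[ℝ] ℝ} (hη : ContDiff ℝ ∞ η)
    (hdη : ∀ x ∈ ball (0 : E) δ, ∀ u v,
      fderiv ℝ η x u v - fderiv ℝ η x v u = B x u v - B 0 u v)
    {X : ℝ × E → E} (hX : ContDiff ℝ ∞ X)
    (h : ∀ t ∈ Icc (0 : ℝ) 1, ∀ x ∈ ball (0 : E) δ, moserPath B (t, x) (X (t, x)) = -η x)
    {c U V : ℝ → E} (hcb : ∀ t ∈ Icc (0 : ℝ) 1, c t ∈ ball (0 : E) δ)
    (hc : ∀ t ∈ Icc (0 : ℝ) 1, HasDerivAt c (X (t, c t)) t)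
    (hU : ∀ t ∈ Icc (0 : ℝ) 1, HasDerivAt U (fderiv ℝ X (t, c t) (0, U t)) t)
    (hV : ∀ t ∈ Icc (0 : ℝ) 1, HasDerivAt V (fderiv ℝ X (t, c t) (0, V t)) t) :
    B (c 1) (U 1) (V 1) = B 0 (U 0) (V 0) := by
  have hδ : (0 : E) ∈ ball (0 : E) δ :=
    mem_ball_self (dist_nonneg.trans_lt (hcb 0 (by simp)))
  have hd : ∀ t ∈ Icc (0 : ℝ) 1, HasDerivAt (fun t => moserPath B (t, c t) (U t) (V t)) 0 t := by
    intro t ht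
    have h1 : HasDerivAt (fun t => B (c t)) (fderiv ℝ B (c t) (X (t, c t))) t :=
      (hB.differentiable (by simp) (c t)).hasFDerivAt.comp_hasDerivAt t (hc t ht)
    have h2 : HasDerivAt (fun t => moserPath B (t, c t))
        (t • fderiv ℝ B (c t) (X (t, c t)) + (1 : ℝ) • (B (c t) - B 0)) t :=
      ((hasDerivAt_id t).smul (h1.sub_const (B 0))).const_add _
    have h3 := (h2.clm_apply (hU t ht)).clm_apply (hV t ht)
    -- This is Cartan's formula in coordinates: `e1` and `e2` give d(ι_X ω_t) = −dη, `e3` identifies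
    -- dη with the time derivative of the path, and `e4` is closedness.
    refine h3.congr_deriv ?_
    have e1 := fderiv_moserField hB hη hX (h t ht) (hcb t ht) (U t) (V t)
    have e2 := fderiv_moserField hB hη hX (h t ht) (hcb t ht) (V t) (U t)
    have e3 := hdη _ (hcb t ht) (U t) (V t)
    have e4 := hcl _ (hcb t ht) (X (t, c t)) (U t) (V t)
    have e5 : moserPath B (t, c t) (U t) (fderiv ℝ X (t, c t) (0, V t)) =
        -moserPath B (t, c t) (fderiv ℝ X (t, c t) (0, V t)) (U t) := by
      have a1 := hanti _ (hcb t ht) (U t) (fderiv ℝ X (t, c t) (0, V t))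
      have a2 := hanti _ hδ (U t) (fderiv ℝ X (t, c t) (0, V t))
      simp [moserPath, a1, a2]
      ring
    simp only [add_apply, smul_apply, sub_apply, smul_eq_mul, one_mul]
    rw [e5]
    linear_combination e1 - e2 - e3 + t * e4
  have hconst := constant_of_has_deriv_right_zero
    (fun t ht => (hd t ht).continuousAt.continuousWithinAt)
    (fun t ht => (hd t (Ico_subset_Icc_self ht)).hasDerivWithinAt) 1 (by simp)
  simpa [moserPath] using hconst

/-- Darboux's theorem relative to a linear Lagrangian subspace, for a globally defined form with
the relevant properties on a ball. -/
theorem exists_moser_diffeo_of_ball {B : E → E →L[ℝ] E →L[ℝ] ℝ} (hB : ContDiff ℝ ∞ B) {R : ℝ}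
    (hR : 0 < R) (hanti : ∀ x ∈ ball (0 : E) R, ∀ a b, B x a b = -B x b a)
    (hcl : ∀ x ∈ ball (0 : E) R, IsClosedFormAt B x)
    (hnd : ∀ v, (∀ w, B 0 v w = 0) → v = 0) {Λ : Submodule ℝ E}
    (hdim : Module.finrank ℝ E = 2 * Module.finrank ℝ Λ)
    (hiso : ∀ x ∈ ball (0 : E) R, x ∈ Λ → ∀ u ∈ Λ, ∀ v ∈ Λ, B x u v = 0) :
    ∃ (φ : E → E) (V : Set E), IsOpen V ∧ (0 : E) ∈ V ∧ ContDiffOn ℝ ∞ φ V ∧ φ 0 = 0 ∧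
      HasFDerivAt φ (ContinuousLinearMap.id ℝ E) 0 ∧
      ∀ x ∈ V, φ x ∈ ball (0 : E) R ∧
        (∀ u v, B (φ x) (fderiv ℝ φ x u) (fderiv ℝ φ x v) = B 0 u v) ∧ (φ x ∈ Λ ↔ x ∈ Λ) := by
  have hτ : ContDiff ℝ ∞ (fun x => B x - B 0) := hB.sub contDiff_const
  have hfτ : ∀ x, fderiv ℝ (fun x => B x - B 0) x = fderiv ℝ B x := fun x =>
    fderiv_sub_const _
  have h0R : (0 : E) ∈ ball (0 : E) R := mem_ball_self hR
  have hstar : ∀ x ∈ ball (0 : E) R, ∀ t ∈ Icc (0 : ℝ) 1, t • x ∈ ball (0 : E) R := by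
    intro x hx t ht
    rw [mem_ball_zero_iff] at hx ⊢
    rw [norm_smul, Real.norm_of_nonneg ht.1]
    exact (mul_le_of_le_one_left (norm_nonneg _) ht.2).trans_lt hx
  set η := radialPrimitive _ hτ
  have hη : ContDiff ℝ ∞ η := contDiff_radialPrimitive hτ
  have hdη : ∀ x ∈ ball (0 : E) R, ∀ u v,
      fderiv ℝ η x u v - fderiv ℝ η x v u = B x u v - B 0 u v := by
    intro x hx u v
    refine fderiv_radialPrimitive_sub hτ x u v (fun t ht a b => ?_) (fun t ht a b c => ?_)
    · have a1 := hanti _ (hstar x hx t ht) a b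
      have a2 := hanti _ h0R a b
      simp [a1, a2]
      ring
    · rw [hfτ]
      exact hcl _ (hstar x hx t ht) a b c
  have hη0 : η 0 = 0 := by
    ext v
    simp [η, radialPrimitive_apply]
  -- The integrand t τ(tx)(x, ·) with τ(0) = 0 is of second order in `x`. By nondegeneracy X and its
  -- space derivative therefore also vanish at 0.
  have hdη0 : ∀ u v, fderiv ℝ η 0 u v = 0 := by
    intro u v
    simp [η, fderiv_radialPrimitive_apply]
  obtain ⟨X, hX, δ₀, hδ₀, hXδ₀⟩ := exists_moserField hB hnd hη
  obtain ⟨δ, hδ, hδ₀', hδR⟩ : ∃ δ > 0, δ ≤ δ₀ ∧ δ ≤ R :=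
    ⟨min δ₀ R, lt_min hδ₀ hR, min_le_left _ _, min_le_right _ _⟩
  have hnd' : ∀ t ∈ Icc (0 : ℝ) 1, ∀ x ∈ ball (0 : E) δ, ∀ v,
      moserPath B (t, x) v = 0 → v = 0 :=
    fun t ht x hx => (hXδ₀ t ht x (ball_subset_ball hδ₀' hx)).1
  have hXeq : ∀ t ∈ Icc (0 : ℝ) 1, ∀ x ∈ ball (0 : E) δ,
      moserPath B (t, x) (X (t, x)) = -η x :=
    fun t ht x hx => (hXδ₀ t ht x (ball_subset_ball hδ₀' hx)).2
  have h0δ : (0 : E) ∈ ball (0 : E) δ := mem_ball_self hδ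
  have hX0 : ∀ t ∈ Icc (0 : ℝ) 1, X (t, 0) = 0 := fun t ht =>
    hnd' t ht 0 h0δ _ (by rw [hXeq t ht 0 h0δ, hη0, neg_zero])
  have hDX0 : ∀ t ∈ Icc (0 : ℝ) 1, ∀ u, fderiv ℝ X (t, 0) (0, u) = 0 := fun t ht u =>
    hnd' t ht 0 h0δ _ (by
      ext v
      have := fderiv_moserField hB hη hX (hXeq t ht) h0δ u v
      rw [hX0 t ht, hdη0] at this
      simpa using this)
  -- For `x ∈ Λ` the segment from 0 to `x` lies in Λ, so isotropy makes `η x` vanish on Λ. Thus X is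
  -- orthogonal to Λ, hence in Λ.
  have htan : ∀ t ∈ Icc (0 : ℝ) 1, ∀ x ∈ ball (0 : E) δ, x ∈ Λ → X (t, x) ∈ Λ := by
    intro t ht x hx hxΛ
    refine mem_of_forall_apply_eq_zero (β := moserPath B (t, x))
      (fun v hv => hnd' t ht x hx v (ContinuousLinearMap.ext hv)) hdim ?_ ?_
    · intro u hu v hv
      simp [moserPath, hiso x (ball_subset_ball hδR hx) hxΛ u hu v hv,
        hiso 0 h0R Λ.zero_mem u hu v hv]
    · intro v hv
      rw [hXeq t ht x hx, neg_apply, radialPrimitive_apply, neg_eq_zero]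
      refine (intervalIntegral.integral_congr (g := fun _ => (0 : ℝ)) fun s hs => ?_).trans
        (by simp)
      rw [uIcc_of_le zero_le_one] at hs
      simp [hiso _ (hstar x (ball_subset_ball hδR hx) s hs) (Λ.smul_mem s hxΛ) x hxΛ v hv,
        hiso 0 h0R Λ.zero_mem x hxΛ v hv]
  obtain ⟨δ', hδ', hflow⟩ := mem_submodule_iff_of_integralCurve hX Λ hδ htan
  obtain ⟨Γ, V₀, hV₀, h0V₀, hΓ, hΓ0, hDΓ, hΓeq⟩ := exists_smooth_integralCurves X hX hX0 hDX0
  -- A sup-norm ball of paths confines the whole curve, not only its endpoint.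
  have hV : IsOpen (V₀ ∩ Γ ⁻¹' ball 0 (min δ δ')) :=
    hΓ.continuousOn.isOpen_inter_preimage hV₀ isOpen_ball
  refine ⟨fun x => Γ x 1, V₀ ∩ Γ ⁻¹' ball 0 (min δ δ'), hV, ⟨h0V₀, ?_⟩, ?_, ?_, ?_, ?_⟩
  · rw [mem_preimage, hΓ0]
    exact mem_ball_self (lt_min hδ hδ')
  · exact (evalPathCLM E 1).contDiff.comp_contDiffOn (hΓ.mono inter_subset_left)
  · simp [hΓ0]
  · exact (evalPathCLM E 1).hasFDerivAt.comp (0 : E) hDΓ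
  rintro x ⟨hx, hxb⟩
  have hpath : ∀ t : I, Γ x t ∈ ball (0 : E) δ ∧ Γ x t ∈ ball (0 : E) δ' := by
    intro t
    rw [mem_preimage, mem_ball_zero_iff] at hxb
    have := ((Γ x).norm_coe_le_norm t).trans_lt hxb
    exact ⟨mem_ball_zero_iff.2 (this.trans_le (min_le_left _ _)),
      mem_ball_zero_iff.2 (this.trans_le (min_le_right _ _))⟩
  have hΓx : HasFDerivAt Γ (fderiv ℝ Γ x) x :=
    (((hΓ x hx).contDiffAt (hV₀.mem_nhds hx)).differentiableAt (by simp)).hasFDerivAt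
  have hφx : fderiv ℝ (fun x => Γ x 1) x = evalPathCLM E 1 ∘L fderiv ℝ Γ x :=
    ((evalPathCLM E 1).hasFDerivAt.comp x hΓx).fderiv
  obtain ⟨c, hc, hc0, hcΓ⟩ := exists_hasDerivAt_of_eq_primitive (hΓeq x hx)
  have hcΓ' : ∀ t (ht : t ∈ Icc (0 : ℝ) 1), c t = Γ x ⟨t, ht⟩ := fun t ht => hcΓ ⟨t, ht⟩
  have hc' : ∀ t ∈ Icc (0 : ℝ) 1, HasDerivAt c (X (t, c t)) t := fun t ht => by
    have := hc t
    rwa [pathExtend_of_mem _ ht, timeSuperposition_apply, ← hcΓ' t ht] at this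
  have hvar : ∀ u, ∃ U : ℝ → E,
      (∀ t ∈ Icc (0 : ℝ) 1, HasDerivAt U (fderiv ℝ X (t, c t) (0, U t)) t) ∧ U 0 = u ∧
        U 1 = fderiv ℝ Γ x u 1 := by
    intro u
    obtain ⟨U, hU, hU0, hUΓ⟩ :=
      exists_hasDerivAt_of_eq_primitive (fderiv_integralCurves X hX hV₀ hΓ hΓeq hx u)
    refine ⟨U, fun t ht => ?_, hU0, hUΓ 1⟩
    have := hU t
    rwa [pathExtend_of_mem _ ht, fderiv_timeSuperposition_apply hX, ← hcΓ' t ht,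
      ← hUΓ ⟨t, ht⟩] at this
  have hc1 : Γ x 1 = c 1 := (hcΓ 1).symm
  refine ⟨ball_subset_ball hδR (hpath 1).1, fun u v => ?_, ?_⟩
  · obtain ⟨U, hU, hU0, hU1⟩ := hvar u
    obtain ⟨V, hV, hV0, hV1⟩ := hvar v
    have := moserPath_integralCurve hB (fun x hx => hanti x (ball_subset_ball hδR hx))
      (fun x hx => hcl x (ball_subset_ball hδR hx)) hη
      (fun x hx => hdη x (ball_subset_ball hδR hx)) hX hXeq
      (fun t ht => by rw [hcΓ' t ht]; exact (hpath _).1) hc' hU hV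
    rw [hU0, hV0, hU1, hV1, ← hc1] at this
    rw [hφx]
    exact this
  · have := hflow c hc' (fun t ht => by rw [hcΓ' t ht]; exact (hpath _).2)
    rwa [← hc1, hc0] at this

/-- Darboux's theorem relative to a linear Lagrangian subspace: a symplectic form on a
neighbourhood of the origin is made constant by a local diffeomorphism preserving the subspace. -/
theorem exists_moser_diffeo {B : E → E →L[ℝ] E →L[ℝ] ℝ} {U : Set E} (hU : IsOpen U)
    (h0U : (0 : E) ∈ U) (hB : ContDiffOn ℝ ∞ B U)
    (hanti : ∀ x ∈ U, ∀ a b, B x a b = -B x b a) (hcl : ∀ x ∈ U, IsClosedFormAt B x)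
    (hnd : ∀ v, (∀ w, B 0 v w = 0) → v = 0) {Λ : Submodule ℝ E}
    (hdim : Module.finrank ℝ E = 2 * Module.finrank ℝ Λ)
    (hiso : ∀ x ∈ U, x ∈ Λ → ∀ u ∈ Λ, ∀ v ∈ Λ, B x u v = 0) :
    ∃ (φ : E → E) (V : Set E), IsOpen V ∧ (0 : E) ∈ V ∧ ContDiffOn ℝ ∞ φ V ∧ φ 0 = 0 ∧
      HasFDerivAt φ (ContinuousLinearMap.id ℝ E) 0 ∧
      ∀ x ∈ V, φ x ∈ U ∧
        (∀ u v, B (φ x) (fderiv ℝ φ x u) (fderiv ℝ φ x v) = B 0 u v) ∧ (φ x ∈ Λ ↔ x ∈ Λ) := by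
  -- The superposition operators need maps defined everywhere, so B is replaced by a global form
  -- agreeing with it near 0.
  obtain ⟨B', hB', W, hW, h0W, hWU, heq⟩ := exists_contDiff_eqOn_of_isCompact hU hB
    (isCompact_singleton (x := (0 : E))) (singleton_subset_iff.2 h0U)
  obtain ⟨R, hR, hball⟩ := Metric.isOpen_iff.1 hW 0 (h0W rfl)
  have hB0 : B' 0 = B 0 := heq (h0W rfl)
  obtain ⟨φ, V, hV, h0V, hφ, hφ0, hφ', h⟩ := exists_moser_diffeo_of_ball hB' hR
    (fun x hx => by rw [heq (hball hx)]; exact hanti x (hWU (hball hx)))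
    (fun x hx => by
      have : fderiv ℝ B' x = fderiv ℝ B x :=
        (heq.eventuallyEq_of_mem (hW.mem_nhds (hball hx))).fderiv_eq
      intro a b c
      rw [this]
      exact hcl x (hWU (hball hx)) a b c)
    (by rwa [hB0]) hdim
    (fun x hx => by rw [heq (hball hx)]; exact hiso x (hWU (hball hx)))
  refine ⟨φ, V, hV, h0V, hφ, hφ0, hφ', fun x hx => ?_⟩
  obtain ⟨h1, h2, h3⟩ := h x hx
  rw [heq (hball h1), hB0] at h2
  exact ⟨hWU (hball h1), h2, h3⟩

end Moser

/-! ### Symplectic linear algebra -/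

section LinearNormalForm

theorem stdSymplecticForm_nondegenerate {n : ℕ} {u : EuclideanSpace ℂ (Fin n)}
    (h : ∀ v, stdSymplecticForm u v = 0) : u = 0 := by
  ext j
  apply Complex.ext
  · have := h (EuclideanSpace.single j Complex.I)
    simpa [stdSymplecticForm, apply_ite, Finset.sum_ite_eq] using this
  · have := h (EuclideanSpace.single j 1)
    simpa [stdSymplecticForm, apply_ite, Finset.sum_ite_eq] using this

theorem finrank_real_euclideanSpace_complex (n : ℕ) :
    Module.finrank ℝ (EuclideanSpace ℂ (Fin n)) = 2 * n := by
  rw [finrank_real_of_complex, finrank_euclideanSpace_fin]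

variable {E : Type*} [NormedAddCommGroup E] [NormedSpace ℝ E] [FiniteDimensional ℝ E]

/-- The real-linear map from `ℂⁿ` sending the real and imaginary unit vectors to given vectors. -/
noncomputable def complexCombination {n : ℕ} (e f : Fin n → E) :
    EuclideanSpace ℂ (Fin n) →ₗ[ℝ] E where
  toFun z := ∑ j, ((z j).re • e j + (z j).im • f j)
  map_add' z w := by
    rw [← Finset.sum_add_distrib]
    refine Finset.sum_congr rfl fun j _ => ?_
    simp only [PiLp.add_apply, Complex.add_re, Complex.add_im]
    module
  map_smul' c z := by
    rw [Finset.smul_sum]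
    refine Finset.sum_congr rfl fun j _ => ?_
    simp [smul_smul]

/-- A Lagrangian subspace of a symplectic vector space extends to a symplectic basis. -/
theorem exists_symplectic_basis {n : ℕ} {β : E →L[ℝ] E →L[ℝ] ℝ}
    (hanti : ∀ a b, β a b = -β b a) (hnd : ∀ v, (∀ w, β v w = 0) → v = 0) {Λ : Submodule ℝ E}
    (hΛ : Module.finrank ℝ Λ = n) (hiso : ∀ u ∈ Λ, ∀ v ∈ Λ, β u v = 0) :
    ∃ e f : Fin n → E, (∀ i, e i ∈ Λ) ∧ (∀ i j, β (e i) (f j) = if i = j then 1 else 0) ∧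
      ∀ i j, β (f i) (f j) = 0 := by
  set b := Module.finBasisOfFinrankEq ℝ Λ hΛ
  choose f hf using fun j => exists_forall_apply_eq hnd Λ (-b.coord j)
  have hfe : ∀ j i, β (f j) (b i) = -if i = j then 1 else 0 := fun j i => by
    rw [hf]
    simp [Finsupp.single_apply]
  have hef : ∀ i j, β (b i) (f j) = if i = j then 1 else 0 := fun i j => by
    rw [hanti, hfe, neg_neg]
  have hee : ∀ i j, β (b i) (b j) = 0 := fun i j => hiso _ (b i).2 _ (b j).2
  -- Adding elements of Λ keeps the pairings with `b`. The factor 1/2 appears because both arguments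
  -- of β(f i, f j) are corrected, each cancelling half.
  refine ⟨fun i => b i, fun j => f j + ∑ k, (β (f k) (f j) / 2) • (b k : E), fun i => (b i).2,
    fun i j => ?_, fun i j => ?_⟩
  · simp [hef, hee]
  · simp [hef, hee, hfe]
    have := hanti (f i) (f j)
    linarith

/-- Linear normal form of a Lagrangian subspace. -/
theorem exists_linear_normalForm {n : ℕ} {β : E →L[ℝ] E →L[ℝ] ℝ}
    (hanti : ∀ a b, β a b = -β b a) (hnd : ∀ v, (∀ w, β v w = 0) → v = 0) {Λ : Submodule ℝ E}
    (hE : Module.finrank ℝ E = 2 * n) (hΛ : Module.finrank ℝ Λ = n)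
    (hiso : ∀ u ∈ Λ, ∀ v ∈ Λ, β u v = 0) :
    ∃ A : EuclideanSpace ℂ (Fin n) ≃L[ℝ] E,
      (∀ u v, β (A u) (A v) = stdSymplecticForm u v) ∧ ∀ z, A z ∈ Λ ↔ z ∈ realPoints n := by
  obtain ⟨e, f, he, hef, hff⟩ := exists_symplectic_basis hanti hnd hΛ hiso
  have hee : ∀ i j, β (e i) (e j) = 0 := fun i j => hiso _ (he i) _ (he j)
  have hfe : ∀ i j, β (f i) (e j) = -if j = i then 1 else 0 := fun i j => by rw [hanti, hef]
  set A := complexCombination e f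
  have hA : ∀ z, A z = ∑ j, ((z j).re • e j + (z j).im • f j) := fun z => rfl
  have hAstd : ∀ u v, β (A u) (A v) = stdSymplecticForm u v := fun u v => by
    simp only [hA, map_sum, map_add, map_smul, sum_apply, add_apply,
      smul_apply, hee, hef, hfe, hff, stdSymplecticForm, smul_eq_mul]
    simp [Finset.sum_add_distrib, mul_comm, sub_eq_add_neg, add_comm]
  -- Pairing with `e i ∈ Λ` reads off imaginary parts, so isotropy forces `z` to be real when `A z ∈
  -- Λ`.
  have heA : ∀ i z, β (e i) (A z) = (z i).im := fun i z => by
    simp [hA, hee, hef]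
  have hinj : Function.Injective A := (injective_iff_map_eq_zero A).2 fun u hu =>
    stdSymplecticForm_nondegenerate fun v => by rw [← hAstd, hu]; simp
  refine ⟨(LinearEquiv.ofInjectiveOfFinrankEq A hinj
    ((finrank_real_euclideanSpace_complex n).trans hE.symm)).toContinuousLinearEquiv, hAstd,
    fun z => ⟨fun hz j => ?_, fun hz => ?_⟩⟩
  · rw [← heA]
    exact hiso _ (he j) _ hz
  · change A z ∈ Λ
    rw [hA]
    refine Λ.sum_mem fun j _ => ?_
    rw [hz j, zero_smul, add_zero]
    exact Λ.smul_mem _ (he j)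

end LinearNormalForm

/-! ### Relative Darboux theorem in a vector space -/

section LocalNormalForm

variable {E : Type u} [NormedAddCommGroup E] [NormedSpace ℝ E] [FiniteDimensional ℝ E]

/-- Darboux's theorem relative to a Lagrangian subspace, with standard model `ℝⁿ ⊆ ℂⁿ`. -/
theorem exists_lagrangian_darboux {n : ℕ} {B : E → E →L[ℝ] E →L[ℝ] ℝ} {U : Set E}
    (hU : IsOpen U) (h0U : (0 : E) ∈ U) (hB : ContDiffOn ℝ ∞ B U)
    (hanti : ∀ x ∈ U, ∀ a b, B x a b = -B x b a) (hcl : ∀ x ∈ U, IsClosedFormAt B x)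
    (hnd : ∀ v, (∀ w, B 0 v w = 0) → v = 0) {Λ : Submodule ℝ E}
    (hE : Module.finrank ℝ E = 2 * n) (hΛ : Module.finrank ℝ Λ = n)
    (hiso : ∀ x ∈ U, x ∈ Λ → ∀ u ∈ Λ, ∀ v ∈ Λ, B x u v = 0) :
    ∃ θ : OpenPartialHomeomorph (EuclideanSpace ℂ (Fin n)) E, 0 ∈ θ.source ∧ θ 0 = 0 ∧
      ContDiffOn ℝ ∞ θ θ.source ∧ ∀ z ∈ θ.source, θ z ∈ U ∧
        (∀ u v, B (θ z) (fderiv ℝ θ z u) (fderiv ℝ θ z v) = stdSymplecticForm u v) ∧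
        (θ z ∈ Λ ↔ z ∈ realPoints n) := by
  obtain ⟨φ, V, hV, h0V, hφ, hφ0, hφ', h⟩ :=
    exists_moser_diffeo hU h0U hB hanti hcl hnd (by omega) hiso
  obtain ⟨A, hA, hAΛ⟩ := exists_linear_normalForm (hanti 0 h0U) hnd hE hΛ
    (hiso 0 h0U Λ.zero_mem)
  have hVo : IsOpen (A ⁻¹' V) := hV.preimage A.continuous
  have hφA : ContDiffOn ℝ ∞ (φ ∘ A) (A ⁻¹' V) :=
    hφ.comp A.contDiff.contDiffOn fun _ hx => hx
  have hφA' : HasFDerivAt (φ ∘ A) (A : EuclideanSpace ℂ (Fin n) →L[ℝ] E) 0 := by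
    rw [← map_zero A] at hφ'
    exact (hφ'.comp (0 : EuclideanSpace ℂ (Fin n)) A.hasFDerivAt).congr_fderiv (by ext; rfl)
  obtain ⟨θ, h0θ, hθV, hθ, -, -⟩ :=
    exists_smooth_localInverse hVo (by simpa using h0V) hφA A hφA'
  refine ⟨θ, h0θ, by simp [hθ, hφ0], hθ ▸ hφA.mono hθV, fun z hz => ?_⟩
  obtain ⟨h1, h2, h3⟩ := h (A z) (hθV hz)
  have hd : fderiv ℝ θ z = fderiv ℝ φ (A z) ∘L (A : EuclideanSpace ℂ (Fin n) →L[ℝ] E) := by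
    rw [hθ]
    exact ((((hφ _ (hθV hz)).contDiffAt (hV.mem_nhds (hθV hz))).differentiableAt
      (by simp)).hasFDerivAt.comp z A.hasFDerivAt).fderiv
  refine ⟨by rw [hθ]; exact h1, fun u v => ?_, ?_⟩
  · rw [hd, hθ, ← hA]
    exact h2 _ _
  · rw [hθ, ← hAΛ]
    exact h3

end LocalNormalForm

/-! ### Alternating forms as bilinear maps, and their pullbacks -/

section AlternatingForms

variable {E E' : Type*} [NormedAddCommGroup E] [NormedSpace ℝ E]
  [NormedAddCommGroup E'] [NormedSpace ℝ E']

theorem update_pair_zero (u v w : E) : Function.update ![u, v] 0 w = ![w, v] := by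
  ext i; fin_cases i <;> rfl

theorem update_pair_one (u v w : E) : Function.update ![u, v] 1 w = ![u, w] := by
  ext i; fin_cases i <;> rfl

/-- The bilinear map underlying an alternating 2-form. -/
noncomputable def ContinuousAlternatingMap.toBilin (η : E [⋀^Fin 2]→L[ℝ] ℝ) :
    E →L[ℝ] E →L[ℝ] ℝ :=
  LinearMap.mkContinuous₂
    (LinearMap.mk₂ ℝ (fun u v => η ![u, v])
      (fun u u' v => by
        simpa only [update_pair_zero] using η.map_update_add ![u, v] 0 u u')
      (fun c u v => by
        simpa only [update_pair_zero] using η.map_update_smul ![u, v] 0 c u)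
      (fun u v v' => by
        simpa only [update_pair_one] using η.map_update_add ![u, v] 1 v v')
      (fun c u v => by
        simpa only [update_pair_one] using η.map_update_smul ![u, v] 1 c v)) ‖η‖
    (fun u v => by
      have := η.le_opNorm ![u, v]
      simpa [Fin.prod_univ_two, mul_assoc] using this)

@[simp] theorem ContinuousAlternatingMap.toBilin_apply (η : E [⋀^Fin 2]→L[ℝ] ℝ) (u v : E) :
    η.toBilin u v = η ![u, v] := rfl

theorem ContinuousAlternatingMap.toBilin_swap (η : E [⋀^Fin 2]→L[ℝ] ℝ) (u v : E) :
    η.toBilin u v = -η.toBilin v u := by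
  have := η.toAlternatingMap.map_swap ![v, u] (i := 0) (j := 1) (by simp)
  have h2 : (![v, u] ∘ Equiv.swap (0 : Fin 2) 1) = ![u, v] := by
    ext i; fin_cases i <;> simp
  rw [h2] at this
  exact this

variable [FiniteDimensional ℝ E] [FiniteDimensional ℝ E']

theorem ContDiffOn.toBilin {η : E → E [⋀^Fin 2]→L[ℝ] ℝ} {U : Set E} (hη : ContDiffOn ℝ ∞ η U) :
    ContDiffOn ℝ ∞ (fun x => (η x).toBilin) U := by
  rw [contDiffOn_clm_apply]
  intro u
  rw [contDiffOn_clm_apply]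
  intro v
  exact (ContinuousAlternatingMap.apply ℝ E ℝ ![u, v]).contDiff.comp_contDiffOn hη

theorem isClosedFormAt_toBilin {η : E → E [⋀^Fin 2]→L[ℝ] ℝ} {U : Set E} (hU : IsOpen U)
    (hη : ContDiffOn ℝ ∞ η U) {x : E} (hx : x ∈ U) (h : extDeriv η x = 0) :
    IsClosedFormAt (fun x => (η x).toBilin) x := by
  have hηx : DifferentiableAt ℝ η x :=
    ((hη x hx).contDiffAt (hU.mem_nhds hx)).differentiableAt (by simp)
  have hbx : DifferentiableAt ℝ (fun x => (η x).toBilin) x :=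
    ((hη.toBilin x hx).contDiffAt (hU.mem_nhds hx)).differentiableAt (by simp)
  have key : ∀ a b c, fderiv ℝ (fun x => (η x).toBilin) x a b c =
      fderiv ℝ (fun x => η x ![b, c]) x a := by
    intro a b c
    have h1 := (hbx.hasFDerivAt.clm_apply (hasFDerivAt_const b x)).clm_apply
      (hasFDerivAt_const c x)
    have h3 := congrArg (fun A => A a) h1.fderiv
    simpa using h3.symm
  intro a b c
  have h1 := congrArg (fun η => η ![a, b, c]) h
  rw [extDeriv_apply hηx] at h1
  change ∑ i : Fin 3, _ = _ at h1
  rw [Fin.sum_univ_three] at h1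
  rw [key, key, key]
  have r0 : Fin.removeNth 0 ![a, b, c] = ![b, c] := by ext i; fin_cases i <;> rfl
  have r1 : Fin.removeNth 1 ![a, b, c] = ![a, c] := by ext i; fin_cases i <;> rfl
  have r2 : Fin.removeNth 2 ![a, b, c] = ![a, b] := by ext i; fin_cases i <;> rfl
  rw [r0, r1, r2] at h1
  simp at h1
  linarith

/-- The pullback of a 2-form, given by bilinear maps. -/
noncomputable def pullbackForm (B : E → E →L[ℝ] E →L[ℝ] ℝ) (G : E' → E) (w : E') :
    E' →L[ℝ] E' →L[ℝ] ℝ :=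
  (B (G w)).bilinearComp (fderiv ℝ G w) (fderiv ℝ G w)

variable {B : E → E →L[ℝ] E →L[ℝ] ℝ} {G : E' → E} {U : Set E} {U' : Set E'}

theorem contDiffOn_pullbackForm (hU' : IsOpen U') (hB : ContDiffOn ℝ ∞ B U)
    (hG : ContDiffOn ℝ ∞ G U') (hGU : MapsTo G U' U) :
    ContDiffOn ℝ ∞ (pullbackForm B G) U' := by
  have hG' : ContDiffOn ℝ ∞ (fderiv ℝ G) U' := hG.fderiv_of_isOpen hU' (by simp)
  rw [contDiffOn_clm_apply]
  intro u
  rw [contDiffOn_clm_apply]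
  intro v
  exact ((hB.comp hG hGU).clm_apply (hG'.clm_apply contDiffOn_const)).clm_apply
    (hG'.clm_apply contDiffOn_const)

/-- The terms with second derivatives of `G` cancel, by symmetry of the second derivative and
antisymmetry of `B`. -/
theorem isClosedFormAt_pullbackForm (hU : IsOpen U) (hU' : IsOpen U') (hB : ContDiffOn ℝ ∞ B U)
    (hG : ContDiffOn ℝ ∞ G U') (hGU : MapsTo G U' U)
    (hanti : ∀ x ∈ U, ∀ a b, B x a b = -B x b a) {w : E'} (hw : w ∈ U')
    (hcl : IsClosedFormAt B (G w)) : IsClosedFormAt (pullbackForm B G) w := by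
  have hGw : ContDiffAt ℝ ∞ G w := (hG w hw).contDiffAt (hU'.mem_nhds hw)
  have hG1 : HasFDerivAt G (fderiv ℝ G w) w := (hGw.differentiableAt (by simp)).hasFDerivAt
  have hG2 : HasFDerivAt (fderiv ℝ G) (fderiv ℝ (fderiv ℝ G) w) w :=
    ((hGw.fderiv_right (m := ∞) (by simp)).differentiableAt (by simp)).hasFDerivAt
  have hBG : HasFDerivAt B (fderiv ℝ B (G w)) (G w) :=
    (((hB _ (hGU hw)).contDiffAt (hU.mem_nhds (hGU hw))).differentiableAt (by simp)).hasFDerivAt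
  have hP : HasFDerivAt (pullbackForm B G) (fderiv ℝ (pullbackForm B G) w) w :=
    ((((contDiffOn_pullbackForm hU' hB hG hGU) w hw).contDiffAt
      (hU'.mem_nhds hw)).differentiableAt (by simp)).hasFDerivAt
  have key : ∀ a b c, fderiv ℝ (pullbackForm B G) w a b c =
      fderiv ℝ B (G w) (fderiv ℝ G w a) (fderiv ℝ G w b) (fderiv ℝ G w c) +
      B (G w) (fderiv ℝ (fderiv ℝ G) w a b) (fderiv ℝ G w c) +
      B (G w) (fderiv ℝ G w b) (fderiv ℝ (fderiv ℝ G) w a c) := by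
    intro a b c
    have h1 := (hP.clm_apply (hasFDerivAt_const b w)).clm_apply (hasFDerivAt_const c w)
    have h2 := ((hBG.comp w hG1).clm_apply (hG2.clm_apply (hasFDerivAt_const b w))).clm_apply
      (hG2.clm_apply (hasFDerivAt_const c w))
    have h3 := congrArg (fun A => A a) (h1.unique h2)
    simp at h3
    linarith
  have hsymm : ∀ a b, fderiv ℝ (fderiv ℝ G) w a b = fderiv ℝ (fderiv ℝ G) w b a :=
    hGw.isSymmSndFDerivAt (by simpa using WithTop.coe_le_coe.2 (le_top (a := (2 : ℕ∞))))
  intro a b c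
  rw [key, key, key]
  have h1 := hcl (fderiv ℝ G w a) (fderiv ℝ G w b) (fderiv ℝ G w c)
  have h2 := hanti _ (hGU hw) (fderiv ℝ G w b) (fderiv ℝ (fderiv ℝ G) w a c)
  have h3 := hanti _ (hGU hw) (fderiv ℝ G w a) (fderiv ℝ (fderiv ℝ G) w b c)
  rw [hsymm b a, hsymm c a, hsymm c b, h2, h3]
  linear_combination h1

end AlternatingForms

/-! ### Forms on the manifold in charts -/

section LocalRepresentative

theorem ContinuousAlternatingMap.compContinuousLinearMap_pair {E F : Type*}
    [NormedAddCommGroup E] [NormedSpace ℝ E] [NormedAddCommGroup F] [NormedSpace ℝ F]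
    (η : F [⋀^Fin 2]→L[ℝ] ℝ) (T : E →L[ℝ] F) (a b : E) :
    η.compContinuousLinearMap T ![a, b] = η ![T a, T b] := by
  rw [ContinuousAlternatingMap.compContinuousLinearMap_apply]
  congr 1
  ext i : 1
  fin_cases i <;> rfl

variable {d : ℕ} {M : Type*} [TopologicalSpace M] [ChartedSpace (EuclideanSpace ℝ (Fin d)) M]

theorem TwoForm.localRep_apply (Ω : TwoForm d M) (p : M) (y a b : EuclideanSpace ℝ (Fin d)) :
    Ω.localRep p y ![a, b] = Ω ((extChartAt (𝓡 d) p).symm y)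
      ![mfderiv (𝓡 d) (𝓡 d) (extChartAt (𝓡 d) p).symm y a,
        mfderiv (𝓡 d) (𝓡 d) (extChartAt (𝓡 d) p).symm y b] :=
  ContinuousAlternatingMap.compContinuousLinearMap_pair (E := EuclideanSpace ℝ (Fin d))
    (F := EuclideanSpace ℝ (Fin d)) _ _ _ _

/-- Evaluation of a 2-form on tangent vectors, with the types of the latter unfolded. -/
theorem TwoForm.apply_congr (Ω : TwoForm d M) {x y : M} (h : x = y)
    (a b : EuclideanSpace ℝ (Fin d)) :
    Ω x ![(a : TangentSpace (𝓡 d) x), (b : TangentSpace (𝓡 d) x)] =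
      Ω y ![(a : TangentSpace (𝓡 d) y), (b : TangentSpace (𝓡 d) y)] := by
  subst h
  rfl

/-- The local representative of a 2-form computes its pullback along any map. -/
theorem TwoForm.localRep_fderiv [IsManifold (𝓡 d) ∞ M] (Ω : TwoForm d M) (p : M)
    {N : Type*} [NormedAddCommGroup N] [NormedSpace ℝ N] {f : N → M} {z : N}
    (hf : MDifferentiableAt 𝓘(ℝ, N) (𝓡 d) f z)
    (hz : f z ∈ (chartAt (EuclideanSpace ℝ (Fin d)) p).source) (u v : N) :
    Ω.localRep p (extChartAt (𝓡 d) p (f z))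
        ![fderiv ℝ (extChartAt (𝓡 d) p ∘ f) z u, fderiv ℝ (extChartAt (𝓡 d) p ∘ f) z v] =
      Ω (f z) ![mfderiv 𝓘(ℝ, N) (𝓡 d) f z u, mfderiv 𝓘(ℝ, N) (𝓡 d) f z v] := by
  have : IsManifold (𝓡 d) 1 M := IsManifold.of_le (n := ∞) (by simp)
  have hz' : f z ∈ (extChartAt (𝓡 d) p).source := by rwa [extChartAt_source]
  have hc : MDifferentiableAt 𝓘(ℝ, N) (𝓡 d) (extChartAt (𝓡 d) p ∘ f) z :=
    (mdifferentiableAt_extChartAt hz).comp z hf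
  have hs : MDifferentiableAt (𝓡 d) (𝓡 d) (extChartAt (𝓡 d) p).symm
      (extChartAt (𝓡 d) p (f z)) :=
    (mdifferentiableOn_extChartAt_symm _ ((extChartAt (𝓡 d) p).map_source hz')).mdifferentiableAt
      ((isOpen_extChartAt_target p).mem_nhds ((extChartAt (𝓡 d) p).map_source hz'))
  have heq : (extChartAt (𝓡 d) p).symm ∘ (extChartAt (𝓡 d) p ∘ f) =ᶠ[𝓝 z] f := by
    filter_upwards [hf.continuousAt.preimage_mem_nhds
      ((isOpen_extChartAt_source p).mem_nhds hz')] with y hy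
    exact (extChartAt (𝓡 d) p).left_inv hy
  have hcomp : ∀ a : N, mfderiv (𝓡 d) (𝓡 d) (extChartAt (𝓡 d) p).symm
      (extChartAt (𝓡 d) p (f z)) (fderiv ℝ (extChartAt (𝓡 d) p ∘ f) z a) =
        mfderiv 𝓘(ℝ, N) (𝓡 d) f z a := by
    intro a
    have h1 := (hs.hasMFDerivAt.comp z hc.hasMFDerivAt).congr_of_eventuallyEq heq.symm
    rw [h1.mfderiv, mfderiv_eq_fderiv]
    rfl
  rw [TwoForm.localRep_apply, hcomp, hcomp]
  exact TwoForm.apply_congr Ω ((extChartAt (𝓡 d) p).left_inv hz') _ _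

end LocalRepresentative

/-! ### Slice charts of the submanifold -/

section SliceChart

variable {n : ℕ} {M : Type*} [TopologicalSpace M]
  [ChartedSpace (EuclideanSpace ℝ (Fin (2 * n))) M] [IsManifold (𝓡 (2 * n)) ∞ M]

/-- Coordinates centred at a point of a Lagrangian submanifold in which it is a linear
subspace. -/
theorem exists_lagrangian_slice {Ω : TwoForm (2 * n) M} {L : Set M}
    (hL : IsLagrangianSubmanifold Ω L) {p : M} (hp : p ∈ L) :
    ∃ (Λ : Submodule ℝ (EuclideanSpace ℝ (Fin (2 * n))))
      (κ : OpenPartialHomeomorph (EuclideanSpace ℝ (Fin (2 * n))) M),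
      Module.finrank ℝ Λ = n ∧ 0 ∈ κ.source ∧ κ 0 = p ∧
      ContMDiffOn (𝓡 (2 * n)) (𝓡 (2 * n)) ∞ κ κ.source ∧
      ContMDiffOn (𝓡 (2 * n)) (𝓡 (2 * n)) ∞ κ.symm κ.target ∧
      (∀ w ∈ κ.source, κ w ∈ L ↔ w ∈ Λ) ∧
      ∀ w ∈ κ.source, w ∈ Λ → ∀ a ∈ Λ, ∀ b ∈ Λ,
        Ω (κ w) ![mfderiv (𝓡 (2 * n)) (𝓡 (2 * n)) κ w a,
          mfderiv (𝓡 (2 * n)) (𝓡 (2 * n)) κ w b] = 0 := by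
  obtain ⟨_, _, hemb, hlag⟩ := hL
  obtain ⟨F, _, _, h⟩ := hemb.isImmersion.isImmersionAt ⟨p, hp⟩
  set ψ := h.codChart
  set d := h.domChart
  set A := h.equiv
  have hψd : ∀ u ∈ d.target, ψ (d.symm u) = A (u, 0) := fun u hu => by
    have := h.writtenInCharts (show u ∈ (h.domChart.extend (𝓡 n)).target by simpa using hu)
    simpa using this
  have hdψ : ∀ u ∈ d.target, ((d.symm u : L) : M) ∈ ψ.source := fun u hu =>
    h.source_subset_preimage_source (d.map_target hu)
  set a := d ⟨p, hp⟩
  have ha : a ∈ d.target := d.map_source h.mem_domChart_source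
  have hda : d.symm a = ⟨p, hp⟩ := d.left_inv h.mem_domChart_source
  set ι : EuclideanSpace ℝ (Fin n) →L[ℝ] EuclideanSpace ℝ (Fin (2 * n)) :=
    (A : (EuclideanSpace ℝ (Fin n) × F) →L[ℝ] _) ∘L ContinuousLinearMap.inl ℝ _ F
  have hι : ∀ u, ι u = A (u, 0) := fun u => rfl
  have hιinj : Function.Injective ι := fun u v huv => by
    have := A.injective huv
    exact congrArg Prod.fst this
  set π : EuclideanSpace ℝ (Fin (2 * n)) →L[ℝ] EuclideanSpace ℝ (Fin n) :=
    ContinuousLinearMap.fst ℝ _ F ∘L (A.symm : _ →L[ℝ] (EuclideanSpace ℝ (Fin n) × F))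
  have hπι : ∀ u, π (ι u) = u := fun u => by simp [π, hι]
  -- Since L has the subspace topology, `O ∩ L` is exactly the domain of `d`; this excludes other
  -- sheets of L near `p`.
  obtain ⟨O, hO, hOd⟩ := isOpen_induced_iff.1 d.open_source
  set κ₀ := (Homeomorph.addRight (ι a)).toOpenPartialHomeomorph ≫ₕ ψ.symm
  have hκ₀ : ∀ w, κ₀ w = ψ.symm (w + ι a) := fun w => rfl
  have hκ₀s : ∀ w, w ∈ κ₀.source ↔ w + ι a ∈ ψ.target := fun w => by simp [κ₀]
  have hκι : ∀ u, u + a ∈ d.target →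
      ι u ∈ κ₀.source ∧ κ₀ (ι u) = ((d.symm (u + a) : L) : M) := fun u hu => by
    have h1 : ι u + ι a = ψ (d.symm (u + a)) := by rw [hψd _ hu, ← map_add, hι]
    rw [hκ₀s, hκ₀, h1]
    exact ⟨ψ.map_source (hdψ _ hu), ψ.left_inv (hdψ _ hu)⟩
  -- The condition on `O` puts points of L in the domain of `d`, hence in the range of `ι`; the
  -- condition on `π` ensures that points of this range are parametrized by `d` and so lie in L.
  set S := (κ₀.source ∩ κ₀ ⁻¹' O) ∩ (fun w => π w + a) ⁻¹' d.target
  have hS : IsOpen S := (κ₀.isOpen_inter_preimage hO).inter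
    (d.open_target.preimage (π.continuous.add continuous_const))
  have h0 : (0 : EuclideanSpace ℝ (Fin (2 * n))) ∈ κ₀.source ∧ κ₀ 0 = p := by
    have := hκι 0 (by simpa using ha)
    rwa [map_zero, zero_add, hda] at this
  have hpO : p ∈ O := by
    have : (⟨p, hp⟩ : L) ∈ d.source := h.mem_domChart_source
    rw [← hOd] at this
    exact this
  have hmem : ∀ w ∈ S, w ∈ LinearMap.range (ι : EuclideanSpace ℝ (Fin n) →ₗ[ℝ] EuclideanSpace ℝ (Fin (2 * n))) →
      ∃ u, ι u = w ∧ u + a ∈ d.target := by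
    rintro _ ⟨-, hw⟩ ⟨u, rfl⟩
    refine ⟨u, rfl, ?_⟩
    have : π (ι u) + a ∈ d.target := hw
    rwa [hπι] at this
  have hsmooth : ContMDiffOn (𝓡 (2 * n)) (𝓡 (2 * n)) ∞ κ₀ κ₀.source := by
    refine (contMDiffOn_symm_of_mem_maximalAtlas h.codChart_mem_maximalAtlas).comp
      (f := fun w => w + ι a) (contDiff_id.add contDiff_const).contMDiff.contMDiffOn ?_
    exact fun w hw => (hκ₀s w).1 hw
  have hsmooth' : ContMDiffOn (𝓡 (2 * n)) (𝓡 (2 * n)) ∞ κ₀.symm κ₀.target := by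
    have h1 : ContMDiff (𝓡 (2 * n)) (𝓡 (2 * n)) ∞
        (fun w : EuclideanSpace ℝ (Fin (2 * n)) => w + -ι a) :=
      (contDiff_id.add contDiff_const).contMDiff
    refine h1.comp_contMDiffOn ((contMDiffOn_of_mem_maximalAtlas
      h.codChart_mem_maximalAtlas).mono ?_)
    intro y hy
    exact hy.1
  refine ⟨LinearMap.range (ι : EuclideanSpace ℝ (Fin n) →ₗ[ℝ] EuclideanSpace ℝ (Fin (2 * n))), κ₀.restrOpen S hS,
    ?_, ⟨h0.1, ⟨h0.1, ?_⟩, ?_⟩, h0.2, hsmooth.mono fun w hw => hw.1,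
    hsmooth'.mono fun y hy => hy.1, ?_, ?_⟩
  · rw [LinearMap.finrank_range_of_inj hιinj, finrank_euclideanSpace_fin]
  · rw [mem_preimage, h0.2]
    exact hpO
  · simpa using ha
  · rintro w ⟨-, hw⟩
    change κ₀ w ∈ L ↔ _
    constructor
    · intro hwL
      have h1 : (⟨κ₀ w, hwL⟩ : L) ∈ d.source := by
        rw [← hOd]
        exact hw.1.2
      have h2 := hψd _ (d.map_source h1)
      rw [d.left_inv h1] at h2
      have h3 : ψ (κ₀ w) = w + ι a := ψ.right_inv ((hκ₀s w).1 hw.1.1)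
      rw [h3, ← hι, ← eq_sub_iff_add_eq, ← map_sub] at h2
      exact ⟨_, h2.symm⟩
    · intro hwΛ
      obtain ⟨u, rfl, hu⟩ := hmem w hw hwΛ
      rw [(hκι u hu).2]
      exact (d.symm (u + a)).2
  · rintro w ⟨-, hw⟩ hwΛ _ ⟨b, rfl⟩ _ ⟨c, rfl⟩
    obtain ⟨u, rfl, hu⟩ := hmem w hw hwΛ
    change Ω (κ₀ (ι u)) ![mfderiv (𝓡 (2 * n)) (𝓡 (2 * n)) κ₀ (ι u) (ι b),
      mfderiv (𝓡 (2 * n)) (𝓡 (2 * n)) κ₀ (ι u) (ι c)] = 0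
    have hopen : IsOpen ((fun u => u + a) ⁻¹' d.target) :=
      d.open_target.preimage (continuous_id.add continuous_const)
    have hD : MDifferentiableAt (𝓡 n) (𝓡 n) (fun u => d.symm (u + a)) u := by
      have h1 : ContMDiffOn (𝓡 n) (𝓡 n) ∞ d.symm d.target :=
        contMDiffOn_symm_of_mem_maximalAtlas h.domChart_mem_maximalAtlas
      have h2 : MDifferentiableAt (𝓡 n) (𝓡 n) d.symm (u + a) :=
        ((h1 _ hu).contMDiffAt (d.open_target.mem_nhds hu)).mdifferentiableAt (by simp)
      have h3 : MDifferentiableAt (𝓡 n) (𝓡 n)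
          (fun u : EuclideanSpace ℝ (Fin n) => u + a) u :=
        ((differentiable_id.add (differentiable_const a)) u).mdifferentiableAt
      exact h2.comp u h3
    have hv : MDifferentiableAt (𝓡 n) (𝓡 (2 * n)) (Subtype.val : L → M) (d.symm (u + a)) :=
      (hemb.contMDiff _).mdifferentiableAt (by simp)
    have hκ : MDifferentiableAt (𝓡 (2 * n)) (𝓡 (2 * n)) κ₀ (ι u) :=
      ((hsmooth _ hw.1.1).contMDiffAt (κ₀.open_source.mem_nhds hw.1.1)).mdifferentiableAt
        (by simp)
    have hιd : MDifferentiableAt (𝓡 n) (𝓡 (2 * n)) ι u := ι.differentiableAt.mdifferentiableAt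
    have heq : (fun u => κ₀ (ι u)) =ᶠ[𝓝 u] Subtype.val ∘ fun u => d.symm (u + a) := by
      filter_upwards [hopen.mem_nhds hu] with y hy
      exact (hκι y hy).2
    have key : ∀ e, mfderiv (𝓡 (2 * n)) (𝓡 (2 * n)) κ₀ (ι u) (ι e) =
        mfderiv (𝓡 n) (𝓡 (2 * n)) (Subtype.val : L → M) (d.symm (u + a))
          (mfderiv (𝓡 n) (𝓡 n) (fun u => d.symm (u + a)) u e) := by
      intro e
      have h1 := hκ.hasMFDerivAt.comp u hιd.hasMFDerivAt
      have h2 := (hv.hasMFDerivAt.comp u hD.hasMFDerivAt).congr_of_eventuallyEq heq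
      have h3 := hasMFDerivAt_unique h1 h2
      have h4 := congrArg (fun T => T e) h3
      rw [mfderiv_eq_fderiv, ι.fderiv] at h4
      exact h4
    rw [key, key]
    exact (TwoForm.apply_congr Ω (hκι u hu).2 _ _).trans (hlag (d.symm (u + a)) _ _)

end SliceChart

/-! ### Darboux charts adapted to the Lagrangian -/

section LagrangianChart

variable {n : ℕ} {M : Type*} [TopologicalSpace M]
  [ChartedSpace (EuclideanSpace ℝ (Fin (2 * n))) M] [IsManifold (𝓡 (2 * n)) ∞ M]

/-- Darboux coordinates on `M` near a point of a Lagrangian submanifold `L`, in which `L` is the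
real part of `ℂⁿ`. -/
theorem exists_lagrangian_chart {Ω : TwoForm (2 * n) M} (hΩ : IsSymplecticForm Ω) {L : Set M}
    (hL : IsLagrangianSubmanifold Ω L) {p : M} (hp : p ∈ L) :
    ∃ Φ : OpenPartialHomeomorph (EuclideanSpace ℂ (Fin n)) M, 0 ∈ Φ.source ∧ Φ 0 = p ∧
      ContMDiffOn 𝓘(ℝ, EuclideanSpace ℂ (Fin n)) (𝓡 (2 * n)) ∞ Φ Φ.source ∧
      ∀ z ∈ Φ.source, (Φ z ∈ L ↔ z ∈ realPoints n) ∧ ∀ u v : EuclideanSpace ℂ (Fin n),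
        Ω (Φ z) ![mfderiv 𝓘(ℝ, EuclideanSpace ℂ (Fin n)) (𝓡 (2 * n)) Φ z u,
          mfderiv 𝓘(ℝ, EuclideanSpace ℂ (Fin n)) (𝓡 (2 * n)) Φ z v] =
          stdSymplecticForm u v := by
  obtain ⟨Λ, κ, hΛ, h0, hκ0, hκ, hκ', hκL, hiso⟩ := exists_lagrangian_slice hL hp
  have hκd : κ.MDifferentiable (𝓡 (2 * n)) (𝓡 (2 * n)) :=
    ⟨hκ.mdifferentiableOn (by simp), hκ'.mdifferentiableOn (by simp)⟩
  have hκat : ∀ w ∈ κ.source, MDifferentiableAt (𝓡 (2 * n)) (𝓡 (2 * n)) κ w :=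
    fun w hw => hκd.mdifferentiableAt hw
  set c := extChartAt (𝓡 (2 * n)) p
  set U := κ.source ∩ κ ⁻¹' (chartAt (EuclideanSpace ℝ (Fin (2 * n))) p).source
  have hU : IsOpen U := κ.isOpen_inter_preimage (chartAt _ p).open_source
  have h0U : (0 : EuclideanSpace ℝ (Fin (2 * n))) ∈ U := by
    refine ⟨h0, ?_⟩
    rw [mem_preimage, hκ0]
    exact mem_chart_source _ p
  -- Smoothness and closedness of Ω are given only in preferred charts, so the form in slice
  -- coordinates is treated as the pullback of a local representative along `G`.
  set G : EuclideanSpace ℝ (Fin (2 * n)) → EuclideanSpace ℝ (Fin (2 * n)) := c ∘ κ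
  have hG : ContDiffOn ℝ ∞ G U :=
    ((contMDiffOn_extChartAt (I := 𝓡 (2 * n)) (n := ∞) (x := p)).comp
      (hκ.mono inter_subset_left) fun w hw => hw.2).contDiffOn
  have hGT : MapsTo G U c.target := fun w hw =>
    c.map_source (by rw [extChartAt_source]; exact hw.2)
  have hT : IsOpen c.target := isOpen_extChartAt_target p
  set B₀ := fun y => (Ω.localRep p y).toBilin
  have hB₀ : ContDiffOn ℝ ∞ B₀ c.target := (hΩ.smooth p).toBilin
  have hanti₀ : ∀ y ∈ c.target, ∀ a b, B₀ y a b = -B₀ y b a := fun y _ a b =>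
    (Ω.localRep p y).toBilin_swap a b
  have hcl₀ : ∀ y ∈ c.target, IsClosedFormAt B₀ y := fun y hy =>
    isClosedFormAt_toBilin hT (hΩ.smooth p) hy (hΩ.closed p y hy)
  set B := pullbackForm B₀ G
  have hBΩ : ∀ w ∈ U, ∀ a b, B w a b = Ω (κ w) ![mfderiv (𝓡 (2 * n)) (𝓡 (2 * n)) κ w a,
      mfderiv (𝓡 (2 * n)) (𝓡 (2 * n)) κ w b] := fun w hw a b =>
    Ω.localRep_fderiv p (hκat w hw.1) hw.2 a b
  have hB : ContDiffOn ℝ ∞ B U := contDiffOn_pullbackForm hU hB₀ hG hGT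
  have hanti : ∀ w ∈ U, ∀ a b, B w a b = -B w b a := fun w hw a b => hanti₀ _ (hGT hw) _ _
  have hcl : ∀ w ∈ U, IsClosedFormAt B w := fun w hw =>
    isClosedFormAt_pullbackForm hT hU hB₀ hG hGT hanti₀ hw (hcl₀ _ (hGT hw))
  have hnd : ∀ v, (∀ w, B 0 v w = 0) → v = 0 := fun v hv => by
    have h1 : mfderiv (𝓡 (2 * n)) (𝓡 (2 * n)) κ 0 v = 0 := by
      refine hΩ.nondegenerate _ _ fun w => ?_
      obtain ⟨w', rfl⟩ := hκd.mfderiv_surjective h0 w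
      exact (hBΩ 0 h0U v w').symm.trans (hv w')
    exact hκd.mfderiv_injective h0 (h1.trans (map_zero _).symm)
  obtain ⟨θ, h0θ, hθ0, hθ, hθU⟩ := exists_lagrangian_darboux hU h0U hB hanti hcl hnd
    finrank_euclideanSpace_fin hΛ fun w hw hwΛ a ha b hb =>
      (hBΩ w hw a b).trans (hiso w hw.1 hwΛ a ha b hb)
  have hsrc : (θ ≫ₕ κ).source = θ.source := by
    rw [OpenPartialHomeomorph.trans_source]
    exact inter_eq_left.2 fun z hz => (hθU z hz).1.1
  have hsm : ContMDiffOn 𝓘(ℝ, EuclideanSpace ℂ (Fin n)) (𝓡 (2 * n)) ∞ (θ ≫ₕ κ) θ.source :=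
    hκ.comp hθ.contMDiffOn fun z hz => (hθU z hz).1.1
  refine ⟨θ ≫ₕ κ, by rwa [hsrc], ?_, by rwa [hsrc], fun z hz => ?_⟩
  · rw [OpenPartialHomeomorph.coe_trans, Function.comp_apply, hθ0, hκ0]
  rw [hsrc] at hz
  obtain ⟨h1, h2, h3⟩ := hθU z hz
  refine ⟨(hκL _ h1.1).trans h3, fun u v => ?_⟩
  have hθz : HasFDerivAt θ (fderiv ℝ θ z) z :=
    (((hθ z hz).contDiffAt (θ.open_source.mem_nhds hz)).differentiableAt (by simp)).hasFDerivAt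
  have hGz : HasFDerivAt G (fderiv ℝ G (θ z)) (θ z) :=
    (((hG _ h1).contDiffAt (hU.mem_nhds h1)).differentiableAt (by simp)).hasFDerivAt
  have hd : fderiv ℝ (c ∘ (θ ≫ₕ κ)) z = fderiv ℝ G (θ z) ∘L fderiv ℝ θ z :=
    (hGz.comp z hθz).fderiv
  have h4 := Ω.localRep_fderiv p (f := θ ≫ₕ κ)
    (((hsm z hz).contMDiffAt (θ.open_source.mem_nhds hz)).mdifferentiableAt (by simp)) h1.2 u v
  rw [hd] at h4
  exact h4.symm.trans (h2 u v)

end LagrangianChart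

/-! ### Translated charts and the uniform radius -/

section Uniform

variable {n : ℕ} {M : Type*} [TopologicalSpace M] [T2Space M]
  [ChartedSpace (EuclideanSpace ℝ (Fin (2 * n))) M]

/-- Translating a Lagrangian Darboux chart along the real part gives adapted ball embeddings
centred at nearby points. -/
theorem exists_ballEmbedding_of_chart {Ω : TwoForm (2 * n) M} {L : Set M}
    (Φ : OpenPartialHomeomorph (EuclideanSpace ℂ (Fin n)) M)
    (hΦ : ContMDiffOn 𝓘(ℝ, EuclideanSpace ℂ (Fin n)) (𝓡 (2 * n)) ∞ Φ Φ.source)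
    (hΦL : ∀ z ∈ Φ.source, (Φ z ∈ L ↔ z ∈ realPoints n))
    (hΦΩ : ∀ z ∈ Φ.source, ∀ u v : EuclideanSpace ℂ (Fin n),
      Ω (Φ z) ![mfderiv 𝓘(ℝ, EuclideanSpace ℂ (Fin n)) (𝓡 (2 * n)) Φ z u,
        mfderiv 𝓘(ℝ, EuclideanSpace ℂ (Fin n)) (𝓡 (2 * n)) Φ z v] = stdSymplecticForm u v)
    {x : EuclideanSpace ℂ (Fin n)} (hx : x ∈ realPoints n) {r : ℝ}
    (hr : closedBall x r ⊆ Φ.source) :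
    IsSymplecticBallEmbedding Ω r (fun z => Φ (z + x)) ∧ IsAdaptedTo (fun z => Φ (z + x)) r L := by
  have hmem : ∀ z ∈ closedBall (0 : EuclideanSpace ℂ (Fin n)) r, z + x ∈ Φ.source := fun z hz =>
    hr (by simpa [mem_closedBall, dist_eq_norm] using hz)
  have hadd : ∀ z, HasFDerivAt (fun z : EuclideanSpace ℂ (Fin n) => z + x)
      (ContinuousLinearMap.id ℝ _) z := fun z => (hasFDerivAt_id z).add_const x
  refine ⟨⟨⟨(fun z => z + x) ⁻¹' Φ.source,
    Φ.open_source.preimage (continuous_id.add continuous_const), hmem, ?_⟩, ?_, ?_⟩, ?_⟩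
  · exact hΦ.comp (contDiff_id.add contDiff_const).contMDiff.contMDiffOn fun z hz => hz
  · have hcompact : CompactSpace (closedBall (0 : EuclideanSpace ℂ (Fin n)) r) :=
      isCompact_iff_compactSpace.1 (isCompact_closedBall 0 r)
    refine (Continuous.isClosedEmbedding ?_ ?_).isEmbedding
    · refine continuousOn_iff_continuous_domRestrict.1 ?_
      exact Φ.continuousOn.comp (continuous_id.add continuous_const).continuousOn hmem
    · rintro ⟨z, hz⟩ ⟨w, hw⟩ h
      exact Subtype.ext (add_right_cancel (Φ.injOn (hmem z hz) (hmem w hw) h))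
  · intro z hz u v
    have h1 : MDifferentiableAt 𝓘(ℝ, EuclideanSpace ℂ (Fin n)) (𝓡 (2 * n)) Φ (z + x) :=
      ((hΦ _ (hmem z hz)).contMDiffAt (Φ.open_source.mem_nhds (hmem z hz))).mdifferentiableAt
        (by simp)
    have h2 : ∀ u, mfderiv 𝓘(ℝ, EuclideanSpace ℂ (Fin n)) (𝓡 (2 * n)) (fun z => Φ (z + x)) z u =
        mfderiv 𝓘(ℝ, EuclideanSpace ℂ (Fin n)) (𝓡 (2 * n)) Φ (z + x) u := by
      intro u
      have h3 := h1.hasMFDerivAt.comp z (hadd z).hasMFDerivAt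
      exact congrArg (fun T => T u) h3.mfderiv
    exact (congrArg₂ (fun a b : EuclideanSpace ℝ (Fin (2 * n)) => Ω (Φ (z + x)) ![a, b])
      (h2 u) (h2 v)).trans (hΦΩ _ (hmem z hz) u v)
  · ext z
    refine and_congr_right fun hz => (hΦL _ (hmem z hz)).trans ?_
    refine forall_congr' fun j => ?_
    simp [hx j]

end Uniform

theorem mainTheorem7 (n : ℕ) (M : Type*) [TopologicalSpace M] [T2Space M]
    [SecondCountableTopology M] [ChartedSpace (EuclideanSpace ℝ (Fin (2 * n))) M]
    [IsManifold (𝓡 (2 * n)) ∞ M] (Ω : TwoForm (2 * n) M) (hΩ : IsSymplecticForm Ω)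
    (L : Set M) (hL : IsLagrangianSubmanifold Ω L) (hLc : IsCompact L) :
    ∃ r : ℝ, 0 < r ∧ ∀ p ∈ L, ∃ e : EuclideanSpace ℂ (Fin n) → M,
      IsSymplecticBallEmbedding Ω r e ∧ IsAdaptedTo e r L ∧ e 0 = p := by
  -- Allowing every radius `s ≤ r` makes the property stable under unions, by taking the minimum, as
  -- induction on compact sets requires.
  suffices h : ∃ r : ℝ, 0 < r ∧ ∀ s, 0 < s → s ≤ r → ∀ p ∈ L, ∃ e : EuclideanSpace ℂ (Fin n) → M,
      IsSymplecticBallEmbedding Ω s e ∧ IsAdaptedTo e s L ∧ e 0 = p by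
    obtain ⟨r, hr, h⟩ := h
    exact ⟨r, hr, h r hr le_rfl⟩
  refine hLc.induction_on (p := fun K => ∃ r : ℝ, 0 < r ∧ ∀ s, 0 < s → s ≤ r → ∀ p ∈ K,
    ∃ e : EuclideanSpace ℂ (Fin n) → M,
      IsSymplecticBallEmbedding Ω s e ∧ IsAdaptedTo e s L ∧ e 0 = p)
    ⟨1, one_pos, by simp⟩ ?_ ?_ ?_
  · rintro K K' hK ⟨r, hr, h⟩
    exact ⟨r, hr, fun s hs hsr p hp => h s hs hsr p (hK hp)⟩
  · rintro K K' ⟨r, hr, h⟩ ⟨r', hr', h'⟩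
    refine ⟨min r r', lt_min hr hr', fun s hs hsr p hp => ?_⟩
    rcases hp with hp | hp
    · exact h s hs (hsr.trans (min_le_left _ _)) p hp
    · exact h' s hs (hsr.trans (min_le_right _ _)) p hp
  · intro p hp
    obtain ⟨Φ, h0, hΦ0, hΦ, h⟩ := exists_lagrangian_chart hΩ hL hp
    obtain ⟨ρ, hρ, hball⟩ := Metric.isOpen_iff.1 Φ.open_source 0 h0
    have hsub : ball (0 : EuclideanSpace ℂ (Fin n)) (ρ / 2) ⊆ Φ.source :=
      (ball_subset_ball (by linarith)).trans hball
    have hnhds : Φ '' ball 0 (ρ / 2) ∈ 𝓝 p := by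
      refine (Φ.isOpen_image_of_subset_source isOpen_ball hsub).mem_nhds ?_
      exact ⟨0, mem_ball_self (by linarith), hΦ0⟩
    -- Centres of norm below ρ/2 and radii at most ρ/3 keep the closed balls inside the ball of
    -- radius ρ, as 1/2 + 1/3 < 1.
    refine ⟨L ∩ Φ '' ball 0 (ρ / 2),
      Filter.inter_mem self_mem_nhdsWithin (mem_nhdsWithin_of_mem_nhds hnhds), ρ / 3,
      by linarith, ?_⟩
    rintro s hs hsρ _ ⟨hqL, x, hx, rfl⟩
    have hxr : x ∈ realPoints n := (h x (hsub hx)).1.1 hqL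
    obtain ⟨h1, h2⟩ := exists_ballEmbedding_of_chart Φ hΦ (fun z hz => (h z hz).1)
      (fun z hz => (h z hz).2) hxr (r := s) (by
        refine Subset.trans (fun z hz => ?_) hball
        rw [mem_ball_zero_iff] at hx ⊢
        rw [mem_closedBall, dist_eq_norm] at hz
        have := norm_add_le (z - x) x
        rw [sub_add_cancel] at this
        linarith)
    exact ⟨_, h1, h2, by simp⟩
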